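/- Let $k$ be any scheme and $0\le i\le n$ integers. Let $V=\mathcal O_k^{2n+2}$ carry the standard symplectic form $\phi$ with symplectic basis $e_1,f_1,\dots,e_{n+1},f_{n+1}$ ($\phi(e_j,f_j)=1$, the form being the orthogonal sum of the hyperbolic planes $\langle e_j,f_j\rangle$), and let $E_j=\langle e_1,\dots,e_j\rangle$, a totally isotropic subbundle. Let $\mathrm{HP}^n\subset \mathrm{Gr}(2,V)$ be the open subscheme parametrizing the rank $2$ subbundles $U\subset V$ on which $\phi$ is nondegenerate, and put $\overline X_{2j}=\mathrm{Gr}(2,E_j^{\perp})\cap \mathrm{HP}^n$ and $X_{2i}=\overline X_{2i}\smallsetminus\overline X_{2i+2}$, with $\overline X_{2i}$ closed in $\mathrm{HP}^n$ and $X_{2i}$ open in $\overline X_{2i}$. That is, $X_{2i}$ is the $k$-scheme such that for every affine $k$-scheme $\operatorname{Spec}R$ the set $X_{2i}(R)$ is, naturally in $\operatorname{Spec}R$, the set of rank $2$ subbundles $U\subset R^{2n+2}$ with $\phi|_U$ nondegenerate and $U\subset E_i^\perp$ such that at no field-valued point of $\operatorname{Spec}R$ the fibre of $U$ is contained in $E_{i+1}^\perp$.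 Such a $k$-scheme exists (it is then unique up to unique isomorphism), and the following holds. (a) The formula $$t\cdot(\alpha,a,\beta,b,r)=(\alpha,\,a,\,\beta+t\alpha,\,b+ta,\,r+t(1-\phi(a,b))),$$ where $\phi$ now also denotes the standard symplectic form $\mathbb A^{2n-2i}\times\mathbb A^{2n-2i}\to\mathbb A^1$, defines a free action of the additive group $\mathbb G_a$ over $k$ on $$\mathbb A_k^{4n-2i+1}=\mathbb A^{i}\times\mathbb A^{2n-2i}\times\mathbb A^{i}\times\mathbb A^{2n-2i}\times\mathbb A^{1},$$ and $X_{2i}$ is the quotient of $\mathbb A_k^{4n-2i+1}$ by this action: there is a $k$-morphism $\pi\colon\mathbb A_k^{4n-2i+1}\to X_{2i}$ which is a Zariski locally trivial principal $\mathbb G_a$-bundle for this action and is its categorical quotient in $k$-schemes. (b) Let $\mathcal V$ be a full subcategory of the category of $k$-schemes, closed under isomorphism, all of whose objects are quasi-compact and quasi-separated, which contains $k$ and $\varnothing$, is closed under $X\sqcup Y$, $X\times_kY$ and passage to quasi-compact open subschemes, and contains every $Y$ for which there are $X\in\mathcal V$ and an affine morphism $Y\to X$ that identifies $Y$ with an open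 subscheme of a Grassmannian bundle $\mathrm{Gr}(r,\mathcal O_X^N)$ over $X$. Let $(A,\partial)$ be a cohomology theory on $\mathcal V$: a contravariant functor $(X,Z)\mapsto A_Z(X)$ to abelian groups on pairs of a scheme $X$ and a closed subset $Z\subset X$ with $X,\,X\smallsetminus Z\in\mathcal V$ (a map $(X',Z')\to(X,Z)$ being a $k$-morphism $f\colon X'\to X$ with $f^{-1}(Z)\subset Z'$; one writes $A(X)=A_X(X)$), with natural maps $\partial\colon A(X\smallsetminus Z)\to A_Z(X)$ such that $$A(X\smallsetminus Z)\xrightarrow{\partial}A_Z(X)\to A(X)\to A(X\smallsetminus Z)\xrightarrow{\partial}A_Z(X)$$ is exact, $A_Z(X)\to A_{Z'}(X')$ is an isomorphism whenever $f\colon X'\to X$ is étale, $Z'=f^{-1}(Z)$ and $f$ induces an isomorphism $Z'\to Z$ (reduced structures), and $A(X)\to A(X\times\mathbb A^1)$ is an isomorphism for every $X\in\mathcal V$. Then for every $S\in\mathcal V$ the scheme $X_{2i}\times_kS$ lies in $\mathcal V$, and pullback along the projection $X_{2i}\times_k S\to S$ is an isomorphism $A(S)\cong A(X_{2i}\times_k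 S)$. -/

import Mathlib

open CategoryTheory Limits MonoidalCategory CartesianMonoidalCategory AlgebraicGeometry Opposite
open TopologicalSpace (Closeds)

universe w u

noncomputable section

namespace QuatProj

/-! ### Subbundles of trivial bundles over affine schemes -/

section Subbundles

variable {R : Type u} [CommRing R]

/-- `U ⊆ R^ι` is a subbundle of rank `r` of the trivial bundle on `Spec R`: the quotient is
projective (so `U` is locally a direct summand) and `U` has rank `r` at every point.
For finite `ι` these `U` are the `R`-points of the Grassmannian `Gr(r, ι)`. -/
structure IsSubbundle {ι : Type} (r : ℕ) (U : Submodule R (ι → R)) : Prop where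
  projective_quotient : Module.Projective R ((ι → R) ⧸ U)
  rank_eq : ∀ p : PrimeSpectrum R, Module.rankAtStalk (R := R) U p = r

/-- The pullback of a subbundle of a trivial bundle along `R → R'`. (For a subbundle `U`, the map
`R' ⊗ U → (R')^ι` is injective, and this is its image.) -/
def pullbackSub {R' : Type u} [CommRing R'] {ι : Type} (g : R →+* R')
    (U : Submodule R (ι → R)) : Submodule R' (ι → R') :=
  Submodule.span R' ((fun v j => g (v j)) '' (U : Set (ι → R)))

variable (R)

/-- The standard symplectic form on `R^{2m}`, the orthogonal sum of `m` hyperbolic planes. The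
vectors with index `(j, 0)` and `(j, 1)` are the symplectic basis `e_j`, `f_j`. -/
def stdForm (m : ℕ) : LinearMap.BilinForm R (Fin m × Fin 2 → R) :=
  LinearMap.mk₂ R (fun v w => ∑ j, (v (j, 0) * w (j, 1) - v (j, 1) * w (j, 0)))
    (by intros; rw [← Finset.sum_add_distrib]
        refine Finset.sum_congr rfl fun j _ => ?_
        simp only [Pi.add_apply]; ring)
    (by intros; rw [Finset.smul_sum]
        refine Finset.sum_congr rfl fun j _ => ?_
        simp only [Pi.smul_apply, smul_eq_mul]; ring)
    (by intros; rw [← Finset.sum_add_distrib]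
        refine Finset.sum_congr rfl fun j _ => ?_
        simp only [Pi.add_apply]; ring)
    (by intros; rw [Finset.smul_sum]
        refine Finset.sum_congr rfl fun j _ => ?_
        simp only [Pi.smul_apply, smul_eq_mul]; ring)

/-- The totally isotropic subspace `E_i ⊆ R^{2m}`, spanned by the first `i` vectors `e_j` of the
standard symplectic basis. -/
def flagE (m i : ℕ) : Submodule R (Fin m × Fin 2 → R) :=
  Submodule.span R {v | ∃ j : Fin m, (j : ℕ) < i ∧ v = Pi.single (j, 0) 1}

/-- The orthogonal complement `E_i^⊥` for the standard symplectic form. -/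
def flagEPerp (m i : ℕ) : Submodule R (Fin m × Fin 2 → R) :=
  (stdForm R m).orthogonal (flagE R m i)

/-- The `R`-points of `HP^n`: rank `2` subbundles `U` of the standard symplectic bundle of rank
`2n+2` on which the form is nondegenerate (i.e. induces `U ≃ U^∨`). -/
def hpPoints (n : ℕ) : Set (Submodule R (Fin (n + 1) × Fin 2 → R)) :=
  {U | IsSubbundle 2 U ∧ ((stdForm R (n + 1)).domRestrict₁₂ U U).IsPerfPair}

/-- The `R`-points of the closed stratum `X̄_{2i} = Gr(2, E_i^⊥) ∩ HP^n`. -/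
def closedStratumPoints (n i : ℕ) : Set (Submodule R (Fin (n + 1) × Fin 2 → R)) :=
  {U | U ∈ hpPoints R n ∧ U ≤ flagEPerp R (n + 1) i}

/-- The `R`-points of the stratum `X_{2i} = X̄_{2i} ∖ X̄_{2i+2}`, an open subscheme of
`X̄_{2i}`: the points of `X̄_{2i}` over `Spec R` that lie at no field-valued point of `Spec R` in
the closed subscheme `X̄_{2i+2}`. -/
def stratumPoints (n i : ℕ) : Set (Submodule R (Fin (n + 1) × Fin 2 → R)) :=
  {U | U ∈ closedStratumPoints R n i ∧
    ∀ (K : Type u) [Field K] (g : R →+* K), pullbackSub g U ∉ closedStratumPoints K n (i + 1)}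

end Subbundles

/-! ### The strata as schemes -/

/-- The `k`-scheme `X` is the stratum `X_{2i}` of `HP^n` over `k`: it comes with a tautological
subbundle such that for every affine `k`-scheme `Spec R` the `k`-morphisms `Spec R ⟶ X` correspond
bijectively, by pullback of the tautological subbundle, to the elements of `stratumPoints R n i`.
As schemes are determined by their functors of points on affine schemes, this determines `X` up to
unique isomorphism. -/
structure IsStratum {k : Scheme.{u}} (n i : ℕ) (X : Over k) where
  taut : ∀ {R : CommRingCat.{u}}, (Spec R ⟶ X.left) → Submodule R (Fin (n + 1) × Fin 2 → R)
  taut_mem : ∀ {R : CommRingCat.{u}} (y : Spec R ⟶ X.left), taut y ∈ stratumPoints R n i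
  taut_comp : ∀ {R R' : CommRingCat.{u}} (g : R ⟶ R') (y : Spec R ⟶ X.left),
    taut (Spec.map g ≫ y) = pullbackSub g.hom (taut y)
  existsUnique : ∀ {R : CommRingCat.{u}} (x : Spec R ⟶ k),
    ∀ U ∈ stratumPoints R n i, ∃! y : Spec R ⟶ X.left, y ≫ X.hom = x ∧ taut y = U

/-! ### Affine spaces and actions of the additive group -/

/-- Affine space `A^ι` as a `k`-scheme. -/
abbrev affineSp (k : Scheme.{u}) (ι : Type u) : Over k := Over.mk (𝔸(ι; k) ↘ k)

/-- The affine line; this is also the underlying scheme of the additive group `G_a`. -/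
abbrev affineLine (k : Scheme.{u}) : Over k := affineSp k PUnit.{u + 1}

/-- The `T`-point of `A^ι` with given coordinates. -/
def pointOf {k : Scheme.{u}} {ι : Type u} (T : Over k) (v : ι → Γ(T.left, ⊤)) :
    T ⟶ affineSp k ι :=
  Over.homMk (AffineSpace.homOfVector T.hom v) (AffineSpace.homOfVector_over _ _)

/-- The coordinates of a `T`-point of `A^ι`. -/
def coordsOf {k : Scheme.{u}} {ι : Type u} {T : Over k} (x : T ⟶ affineSp k ι) :
    ι → Γ(T.left, ⊤) :=
  fun j => x.left.appTop (AffineSpace.coord k j)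

/-- A morphism `σ : G_a × P ⟶ P` on `T`-points, where `G_a(T) = Γ(T, O_T)`. -/
def actBy {k : Scheme.{u}} {P : Over k} (σ : affineLine k ⊗ P ⟶ P) {T : Over k}
    (t : Γ(T.left, ⊤)) (x : T ⟶ P) : T ⟶ P :=
  lift (pointOf T fun _ => t) x ≫ σ

/-- `σ` is an action of the additive group scheme `G_a` on `P`. -/
structure IsGaAction {k : Scheme.{u}} {P : Over k} (σ : affineLine k ⊗ P ⟶ P) : Prop where
  zero_act : ∀ {T : Over k} (x : T ⟶ P), actBy σ 0 x = x
  add_act : ∀ {T : Over k} (s t : Γ(T.left, ⊤)) (x : T ⟶ P),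
    actBy σ (s + t) x = actBy σ s (actBy σ t x)

/-- The action `σ` is free: `G_a(T)` acts freely on `P(T)` for every `k`-scheme `T`. -/
def IsFreeGa {k : Scheme.{u}} {P : Over k} (σ : affineLine k ⊗ P ⟶ P) : Prop :=
  ∀ {T : Over k} (t : Γ(T.left, ⊤)) (x : T ⟶ P), actBy σ t x = x → t = 0

/-- `π : P ⟶ X` exhibits `X` as the quotient of `P` by the action `σ` of `G_a`: it is a Zariski
locally trivial principal `G_a`-bundle (`G_a × P ≅ P ×_X P` via `(t, p) ↦ (t·p, p)`, and `π` has
sections locally on `X`), and it is the categorical quotient. -/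
structure IsGaQuotient {k : Scheme.{u}} {P X : Over k} (σ : affineLine k ⊗ P ⟶ P)
    (π : P ⟶ X) : Prop where
  isPullback : IsPullback σ (snd (affineLine k) P) π π
  locallyTrivial : ∀ x : X.left, ∃ U : X.left.Opens, x ∈ U ∧
    ∃ s : (U : Scheme.{u}) ⟶ P.left, s ≫ π.left = U.ι
  isCoequalizer : Nonempty (IsColimit (Cofork.ofπ π isPullback.w))

/-- The coordinates `(α, a, β, b, r)` on
`A^i × A^{2n-2i} × A^i × A^{2n-2i} × A^1 = A^{4n-2i+1}`. -/
abbrev CellIdx (n i : ℕ) : Type u :=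
  ULift.{u} (Fin i ⊕ (Fin (n - i) × Fin 2) ⊕ Fin i ⊕ (Fin (n - i) × Fin 2) ⊕ Unit)

/-- The formula
`t · (α, a, β, b, r) = (α, a, β + t α, b + t a, r + t (1 - φ(a, b)))`. -/
def cellFormula {R : Type u} [CommRing R] (n i : ℕ) (t : R) (x : CellIdx.{u} n i → R) :
    CellIdx.{u} n i → R :=
  let α : Fin i → R := fun j => x ⟨.inl j⟩
  let a : Fin (n - i) × Fin 2 → R := fun j => x ⟨.inr (.inl j)⟩
  let β : Fin i → R := fun j => x ⟨.inr (.inr (.inl j))⟩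
  let b : Fin (n - i) × Fin 2 → R := fun j => x ⟨.inr (.inr (.inr (.inl j)))⟩
  let r : R := x ⟨.inr (.inr (.inr (.inr ())))⟩
  fun c => match c with
    | ⟨.inl j⟩ => α j
    | ⟨.inr (.inl j)⟩ => a j
    | ⟨.inr (.inr (.inl j))⟩ => β j + t * α j
    | ⟨.inr (.inr (.inr (.inl j)))⟩ => b j + t * a j
    | ⟨.inr (.inr (.inr (.inr ())))⟩ => r + t * (1 - stdForm R (n - i) a b)

/-- The morphism `G_a × A^{4n-2i+1} ⟶ A^{4n-2i+1}` given by `cellFormula`. -/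
def cellAction (k : Scheme.{u}) (n i : ℕ) :
    affineLine k ⊗ affineSp k (CellIdx.{u} n i) ⟶ affineSp k (CellIdx.{u} n i) :=
  pointOf _ (cellFormula n i (coordsOf (fst (affineLine k) (affineSp k (CellIdx.{u} n i))) ⟨⟩)
    (coordsOf (snd (affineLine k) (affineSp k (CellIdx.{u} n i)))))

/-! ### Categories of schemes and cohomology theories -/

/-- The open subscheme `U` of `X`, over `k`. -/
abbrev openSub {k : Scheme.{u}} (X : Over k) (U : X.left.Opens) : Over k :=
  Over.mk (U.ι ≫ X.hom)

/-- `p : Y ⟶ X` identifies `Y` with an open subscheme of the Grassmannian bundle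
`Gr(r, O_X^N)` over `X`: there is a subbundle of rank `r` of `O_Y^N` such that, for every affine
scheme `Spec R` over `X` and every subbundle `M` of rank `r` of `R^N`, the functor of lifts of
`Spec R ⟶ X` to `Y` that induce `M` is represented by an open subscheme `W` of `Spec R`. -/
def IsOpenInGrassmannian {k : Scheme.{u}} (r N : ℕ) {X Y : Over k} (p : Y ⟶ X) : Prop :=
  ∃ taut : ∀ {R : CommRingCat.{u}}, (Spec R ⟶ Y.left) → Submodule R (Fin N → R),
    (∀ {R : CommRingCat.{u}} (y : Spec R ⟶ Y.left), IsSubbundle r (taut y)) ∧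
    (∀ {R R' : CommRingCat.{u}} (g : R ⟶ R') (y : Spec R ⟶ Y.left),
      taut (Spec.map g ≫ y) = pullbackSub g.hom (taut y)) ∧
    ∀ {R : CommRingCat.{u}} (x : Spec R ⟶ X.left) (M : Submodule R (Fin N → R)),
      IsSubbundle r M →
      ∃ W : (Spec R).Opens, ∀ {R' : CommRingCat.{u}} (g : R ⟶ R'),
        (∀ y y' : Spec R' ⟶ Y.left,
          y ≫ p.left = Spec.map g ≫ x → taut y = pullbackSub g.hom M →
          y' ≫ p.left = Spec.map g ≫ x → taut y' = pullbackSub g.hom M → y = y') ∧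
        ((∃ y : Spec R' ⟶ Y.left, y ≫ p.left = Spec.map g ≫ x ∧ taut y = pullbackSub g.hom M) ↔
          ∀ z : Spec R', Spec.map g z ∈ W)

/-- The conditions on a category `V` of `k`-schemes (a full subcategory of all `k`-schemes) on
which cohomology theories are considered. -/
structure IsAdmissible {k : Scheme.{u}} (V : ObjectProperty (Over k)) : Prop where
  iso_mem : ∀ {X Y : Over k}, (X ≅ Y) → V X → V Y
  compactSpace : ∀ {X : Over k}, V X → CompactSpace X.left
  quasiSeparatedSpace : ∀ {X : Over k}, V X → QuasiSeparatedSpace X.left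
  base_mem : V (Over.mk (𝟙 k))
  empty_mem : ∀ X : Over k, IsEmpty X.left → V X
  coprod_mem : ∀ {X Y : Over k}, V X → V Y → V (X ⨿ Y)
  prod_mem : ∀ {X Y : Over k}, V X → V Y → V (X ⊗ Y)
  open_mem : ∀ {X : Over k}, V X → ∀ U : X.left.Opens, IsCompact (U : Set X.left) →
    V (openSub X U)
  grassmannian_mem : ∀ {X Y : Over k} (p : Y ⟶ X) (r N : ℕ), V X → IsAffineHom p.left →
    IsOpenInGrassmannian r N p → V Y

/-- A scheme `X` and a closed subset `Z` such that `X` and `X ∖ Z` are in `V`. -/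
structure VPair {k : Scheme.{u}} (V : ObjectProperty (Over k)) where
  X : Over k
  Z : Closeds X.left
  mem : V X
  compl_mem : V (openSub X Z.compl)

/-- A morphism `(X', Z') ⟶ (X, Z)` is a `k`-morphism `f : X' ⟶ X` with `f⁻¹(Z) ⊆ Z'`. -/
@[ext]
structure VPair.Hom {k : Scheme.{u}} {V : ObjectProperty (Over k)} (P Q : VPair V) where
  f : P.X ⟶ Q.X
  preimage_le : ∀ x : P.X.left, f.left x ∈ Q.Z → x ∈ P.Z

instance {k : Scheme.{u}} {V : ObjectProperty (Over k)} : Category (VPair V) where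
  Hom := VPair.Hom
  id P := ⟨𝟙 _, fun x hx => by simpa using hx⟩
  comp F G := ⟨F.f ≫ G.f, fun x hx => F.preimage_le x (G.preimage_le _ (by simpa using hx))⟩
  id_comp F := VPair.Hom.ext (Category.id_comp _)
  comp_id F := VPair.Hom.ext (Category.comp_id _)
  assoc F G H := VPair.Hom.ext (Category.assoc _ _ _)

section Pairs

variable {k : Scheme.{u}} {V : ObjectProperty (Over k)} (hV : IsAdmissible V)

/-- The pair `(X, X)`; its cohomology is `A(X) = A_X(X)`. -/
def fullPair (X : Over k) (hX : V X) : VPair V where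
  X := X
  Z := ⊤
  mem := hX
  compl_mem := hV.empty_mem _ ⟨fun x => x.2 trivial⟩

/-- A morphism `X' ⟶ X` as a morphism of pairs `(X', X') ⟶ (X, X)`. -/
def fullMap {X' X : Over k} (hX' : V X') (hX : V X) (f : X' ⟶ X) :
    fullPair hV X' hX' ⟶ fullPair hV X hX :=
  VPair.Hom.mk f fun _ _ => trivial

/-- The pair `(X ∖ Z, X ∖ Z)` attached to `(X, Z)`. -/
def complPair (P : VPair V) : VPair V := fullPair hV (openSub P.X P.Z.compl) P.compl_mem

/-- The morphism `(X, X) ⟶ (X, Z)` given by the identity; it induces the extension of supports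
`A_Z(X) → A(X)`. -/
def extMap (P : VPair V) : fullPair hV P.X P.mem ⟶ P :=
  VPair.Hom.mk (𝟙 P.X) fun _ _ => trivial

/-- The inclusion `X ∖ Z ⟶ X`, inducing the restriction `A(X) → A(X ∖ Z)`. -/
def resMap (P : VPair V) : complPair hV P ⟶ fullPair hV P.X P.mem :=
  fullMap hV P.compl_mem P.mem (Over.homMk (Scheme.Opens.ι P.Z.compl))

end Pairs

/-- A cohomology theory `(A, ∂)` on the category `V` of `k`-schemes. -/
structure CohomologyTheory {k : Scheme.{u}} {V : ObjectProperty (Over k)}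
    (hV : IsAdmissible V) where
  /-- The functor `(X, Z) ↦ A_Z(X)`. -/
  A : (VPair V)ᵒᵖ ⥤ AddCommGrpCat.{w}
  /-- The boundary maps `∂ : A(X ∖ Z) → A_Z(X)`. -/
  bd : ∀ P : VPair V, A.obj (op (complPair hV P)) ⟶ A.obj (op P)
  /-- Naturality of `∂`: here `g` is the map `X' ∖ Z' ⟶ X ∖ Z` induced by `f`. -/
  bd_natural : ∀ {P Q : VPair V} (f : P ⟶ Q) (g : complPair hV P ⟶ complPair hV Q),
    g ≫ resMap hV Q = resMap hV P ≫ fullMap hV P.mem Q.mem f.f →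
    bd Q ≫ A.map f.op = A.map g.op ≫ bd P
  /-- Localization. -/
  exact_supp : ∀ P : VPair V, Function.Exact (bd P) (A.map (extMap hV P).op)
  exact_total : ∀ P : VPair V,
    Function.Exact (A.map (extMap hV P).op) (A.map (resMap hV P).op)
  exact_open : ∀ P : VPair V, Function.Exact (A.map (resMap hV P).op) (bd P)
  /-- Étale excision: `f` is étale, `Z' = f⁻¹(Z)`, and `f` induces an isomorphism from
  `f⁻¹(Z)` to `Z`, where `Z` has the reduced scheme structure (and hence so has
  `f⁻¹(Z) = Z ×_X X'`, as `f` is étale). -/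
  excision : ∀ {P Q : VPair V} (f : P ⟶ Q), Etale f.f.left →
    (∀ x : P.X.left, f.f.left x ∈ Q.Z ↔ x ∈ P.Z) →
    IsIso (pullback.fst (Scheme.IdealSheafData.vanishingIdeal Q.Z).subschemeι f.f.left) →
    IsIso (A.map f.op)
  /-- Homotopy invariance. -/
  homotopy : ∀ (X : Over k) (hX : V X) (hXA : V (X ⊗ affineLine k)),
    IsIso (A.map (fullMap hV hXA hX (fst X (affineLine k))).op)

/-- The pullback `f^A : A(X) → A(X')` along `f : X' ⟶ X`. -/
def CohomologyTheory.pull {k : Scheme.{u}} {V : ObjectProperty (Over k)} {hV : IsAdmissible V}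
    (A : CohomologyTheory.{w} hV) {X' X : Over k} (hX' : V X') (hX : V X) (f : X' ⟶ X) :
    A.A.obj (op (fullPair hV X hX)) ⟶ A.A.obj (op (fullPair hV X' hX')) :=
  A.A.map (fullMap hV hX' hX f).op

end QuatProj

end

open QuatProj

/-!
A plane `U` on which `φ` is nondegenerate corresponds to the bivector `W ∈ Λ²U` with `φ(W) = 1`, so
the normalized Plücker relations present `HP^n`, and likewise its intersection with
`Gr(2, E_i^⊥)`, as an affine scheme over `k`. Inside the latter, `X_{2i}` is the open locus where
the column `(W_{p f})_p` of `f = f_{i+1}` is unimodular. If `W = u ∧ v` with `u_f = 0`, `v_f = 1`,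
then `u` is the `f`-column of `W`, whereas `v` is determined up to `v ↦ v + t u`; the pairs `(u, v)`
with `φ(u, v) = 1` form the affine space of the theorem, and the ambiguity in `v` is the
`𝔾_a`-action. A relation `∑ e_p W_{p f} = 1` singles out one `v`, and such a relation exists over
every affine open subscheme of `X_{2i}`, so the quotient map is a Zariski locally trivial torsor.
Consequently `A(X_{2i} × S) → A(𝔸^{4n-2i+1} × S)` is an isomorphism by the five lemma along an open
cover, and homotopy invariance identifies the target with `A(S)`.
-/

noncomputable section

namespace QuatProj

/-! ### Subbundles -/

section SubbundleLemmas

variable {R R' : Type u} [CommRing R] [CommRing R'] {κ : Type} {r : ℕ} {U : Submodule R (κ → R)}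

lemma comp_mem_pullbackSub (g : R →+* R') {x : κ → R} (hx : x ∈ U) :
    (fun a => g (x a)) ∈ pullbackSub g U :=
  Submodule.subset_span ⟨x, hx, rfl⟩

lemma pullbackSub_span (g : R →+* R') (S : Set (κ → R)) :
    pullbackSub g (Submodule.span R S) = Submodule.span R' ((fun v j => g (v j)) '' S) := by
  let φ : (κ → R) →ₛₗ[g] (κ → R') :=
    { toFun v j := g (v j)
      map_add' _ _ := funext fun _ => map_add g _ _
      map_smul' _ _ := funext fun _ => map_mul g _ _ }
  have hS : Submodule.span R S ≤ (Submodule.span R' (φ '' S)).comap φ :=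
    Submodule.span_le.2 fun v hv => Submodule.subset_span ⟨v, hv, rfl⟩
  exact le_antisymm (Submodule.span_le.2 (Set.image_subset_iff.2 hS))
    (Submodule.span_mono (Set.image_mono Submodule.subset_span))

lemma isSubbundle_range [Finite κ] {M : Type u} [AddCommGroup M] [Module R M]
    (hM : ∀ p : PrimeSpectrum R, Module.rankAtStalk (R := R) M p = r)
    {f : M →ₗ[R] (κ → R)} {q : (κ → R) →ₗ[R] M} (hq : q ∘ₗ f = LinearMap.id) :
    IsSubbundle r (LinearMap.range f) where
  projective_quotient := by
    have hqf (x : M) : q (f x) = x := LinearMap.congr_fun hq x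
    refine Module.Projective.of_split ((LinearMap.range f).liftQ (LinearMap.id - f ∘ₗ q) ?_)
      (LinearMap.range f).mkQ ?_
    · rintro _ ⟨x, rfl⟩
      simp [hqf]
    · ext1
      ext1 x
      simp
  rank_eq p := by
    have e : M ≃ₗ[R] LinearMap.range f := LinearEquiv.ofLeftInverse (LinearMap.congr_fun hq)
    rw [← Module.rankAtStalk_eq_of_equiv e, hM]

namespace IsSubbundle

lemma exists_retraction (h : IsSubbundle r U) :
    ∃ q : (κ → R) →ₗ[R] U, q ∘ₗ U.subtype = LinearMap.id := by
  have := h.projective_quotient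
  obtain ⟨s, hs⟩ := Module.projective_lifting_property U.mkQ LinearMap.id U.mkQ_surjective
  have hs (x : κ → R) : U.mkQ (s (U.mkQ x)) = U.mkQ x := LinearMap.congr_fun hs (U.mkQ x)
  refine ⟨LinearMap.codRestrict U (LinearMap.id - s ∘ₗ U.mkQ) fun x => ?_, ?_⟩
  · rw [← Submodule.Quotient.mk_eq_zero U, ← Submodule.mkQ_apply]
    simp [-Submodule.mkQ_apply, hs]
  · ext1 x
    ext1
    simp [(Submodule.Quotient.mk_eq_zero U).2 x.2]

lemma finite [Finite κ] (h : IsSubbundle r U) : Module.Finite R U := by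
  obtain ⟨q, hq⟩ := h.exists_retraction
  exact Module.Finite.of_surjective q fun x => ⟨x, LinearMap.congr_fun hq x⟩

lemma projective [Finite κ] (h : IsSubbundle r U) : Module.Projective R U := by
  obtain ⟨q, hq⟩ := h.exists_retraction
  exact Module.Projective.of_split U.subtype q hq

open TensorProduct in
lemma pullback [Finite κ] (h : IsSubbundle r U) (g : R →+* R') :
    IsSubbundle r (pullbackSub g U) := by
  classical
  have := Fintype.ofFinite κ
  have := h.finite
  have := h.projective
  obtain ⟨q, hq⟩ := h.exists_retraction
  let _ : Algebra R R' := g.toAlgebra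
  let e : R' ⊗[R] (κ → R) ≃ₗ[R'] (κ → R') := piScalarRight R R' R' κ
  let f : R' ⊗[R] U →ₗ[R'] (κ → R') := e.toLinearMap ∘ₗ U.subtype.baseChange R'
  have hf (x : U) : f (1 ⊗ₜ x) = fun a => g (x.1 a) := by
    ext a
    simp [f, e, Algebra.smul_def, RingHom.algebraMap_toAlgebra]
  have hrange : LinearMap.range f = pullbackSub g U := by
    rw [LinearMap.range_eq_map, ← Submodule.baseChange_top, Submodule.baseChange_eq_span,
      Submodule.map_span, pullbackSub]
    congr 1
    ext v
    simp [hf]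
  rw [← hrange]
  refine isSubbundle_range (fun p => ?_) (q := q.baseChange R' ∘ₗ e.symm.toLinearMap) ?_
  · rw [Module.rankAtStalk_baseChange, h.rank_eq]
  · ext x
    simpa [f] using congrArg (1 ⊗ₜ[R] ·) (LinearMap.congr_fun hq x)

lemma exists_basis_of_isLocalRing [IsLocalRing R] [Finite κ] (h : IsSubbundle r U) :
    Nonempty (Module.Basis (Fin r) R U) := by
  have := h.finite
  have := h.projective
  have : Module.Free R U := Module.free_of_flat_of_isLocalRing
  have hr : Module.finrank R U = r := by
    rw [← h.rank_eq (IsLocalRing.closedPoint R), Module.rankAtStalk_eq_finrank_of_free]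
    rfl
  exact ⟨Module.finBasisOfFinrankEq R U hr⟩

lemma exists_local_generators [Finite κ] (h : IsSubbundle r U) (p : PrimeSpectrum R) :
    ∃ b : Fin r → κ → Localization.AtPrime p.asIdeal, ∀ x ∈ U, ∃ c : Fin r →
      Localization.AtPrime p.asIdeal, ∀ a, algebraMap R _ (x a) = ∑ i, c i * b i a := by
  let g := algebraMap R (Localization.AtPrime p.asIdeal)
  obtain ⟨b⟩ := (h.pullback g).exists_basis_of_isLocalRing
  refine ⟨fun i => b i, fun x hx => ?_⟩
  let gx : pullbackSub g U := ⟨_, comp_mem_pullbackSub g hx⟩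
  refine ⟨b.repr gx, fun a => ?_⟩
  have hx := congrFun (congrArg Subtype.val (b.sum_repr gx)) a
  simp only [Submodule.coe_sum, Submodule.coe_smul, Finset.sum_apply, Pi.smul_apply] at hx
  exact hx.symm

end IsSubbundle

lemma eq_zero_of_forall_localization {x : R}
    (h : ∀ p : PrimeSpectrum R, algebraMap R (Localization.AtPrime p.asIdeal) x = 0) : x = 0 :=
  eq_zero_of_localization x fun m hm => h ⟨m, hm.isPrime⟩

lemma rankAtStalk_eq_of_comp_eq_smul {M N : Type u} [AddCommGroup M] [AddCommGroup N] [Module R M]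
    [Module R N] {p : PrimeSpectrum R} {c : R} (hc : c ∉ p.asIdeal) {f : M →ₗ[R] N}
    {h : N →ₗ[R] M} (hfh : f ∘ₗ h = c • LinearMap.id) (hhf : h ∘ₗ f = c • LinearMap.id) :
    Module.rankAtStalk (R := R) M p = Module.rankAtStalk (R := R) N p := by
  rw [Module.rankAtStalk_eq_finrank_tensorProduct, Module.rankAtStalk_eq_finrank_tensorProduct]
  let Rp := Localization.AtPrime p.asIdeal
  have hu : IsUnit (algebraMap R Rp c) :=
    IsLocalization.map_units (M := p.asIdeal.primeCompl) Rp ⟨c, hc⟩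
  have bijective_comp {M N : Type u} [AddCommGroup M] [AddCommGroup N] [Module R M] [Module R N]
      {f : M →ₗ[R] N} {h : N →ₗ[R] M} (hfh : f ∘ₗ h = c • LinearMap.id) :
      Function.Bijective (f.baseChange Rp ∘ h.baseChange Rp) := by
    have heq : f.baseChange Rp ∘ h.baseChange Rp = (algebraMap R Rp c • ·) := by
      rw [← LinearMap.coe_comp, ← LinearMap.baseChange_comp, hfh]
      ext y
      simp
    rw [heq]
    exact hu.smul_bijective
  exact (LinearEquiv.ofBijective (f.baseChange Rp)
    ⟨(bijective_comp hhf).injective.of_comp, (bijective_comp hfh).surjective.of_comp⟩).finrank_eq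

end SubbundleLemmas

/-! ### Plücker coordinates of nondegenerate planes -/

section Plucker

open Submodule (subset_span)

variable {R R' : Type u} [CommRing R] [CommRing R'] {κ J : Type} [Fintype J] (s t : J → κ)

/-- The alternating form `∑ j, (x_{s j} y_{t j} - x_{t j} y_{s j})`. The index maps need not be
jointly surjective, so that the restriction of the standard symplectic form to `E_i^⊥` also has this
shape. -/
def pairingForm : LinearMap.BilinForm R (κ → R) :=
  ∑ j, (.linMulLin (.proj (s j)) (.proj (t j)) - .linMulLin (.proj (t j)) (.proj (s j)))

lemma pairingForm_apply (x y : κ → R) :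
    pairingForm s t x y = ∑ j, (x (s j) * y (t j) - x (t j) * y (s j)) := by
  simp [pairingForm]

lemma isAlt_pairingForm : (pairingForm s t : LinearMap.BilinForm R (κ → R)).IsAlt := fun x => by
  simp [pairingForm_apply, mul_comm]

lemma pairingForm_map (g : R →+* R') (x y : κ → R) :
    pairingForm s t (fun a => g (x a)) (fun a => g (y a)) = g (pairingForm s t x y) := by
  simp [pairingForm_apply]

/-- The normalized Plücker coordinates of a plane `U` on which `pairingForm s t` is nondegenerate:
`W` is the decomposable bivector generating `Λ²U` on which the form takes the value `1`. -/
structure IsPlucker (W : κ → κ → R) : Prop where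
  alt : ∀ a, W a a = 0
  skew : ∀ a b, W a b = -W b a
  rel : ∀ a b c d, W a b * W c d - W a c * W b d + W a d * W b c = 0
  norm : ∑ j, W (s j) (t j) = 1

/-- The plane with Plücker coordinates `W`, spanned by the rows of `W`. -/
def rowSpan (W : κ → κ → R) : Submodule R (κ → R) := Submodule.span R (Set.range W)

lemma row_mem_rowSpan (W : κ → κ → R) (a : κ) : W a ∈ rowSpan W :=
  subset_span ⟨a, rfl⟩

lemma pullbackSub_rowSpan (g : R →+* R') (W : κ → κ → R) :
    pullbackSub g (rowSpan W) = rowSpan fun a b => g (W a b) := by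
  rw [rowSpan, pullbackSub_span, rowSpan, ← Set.range_comp]
  rfl

lemma isPlucker_wedge {u v : κ → R} (h : pairingForm s t u v = 1) :
    IsPlucker s t fun a b => u a * v b - v a * u b where
  alt a := by ring
  skew a b := by ring
  rel a b c d := by ring
  norm := by simp only [← h, pairingForm_apply, mul_comm]

variable {s t} {W W' : κ → κ → R}

namespace IsPlucker

lemma map (g : R →+* R') (hW : IsPlucker s t W) : IsPlucker s t fun a b => g (W a b) where
  alt a := by rw [hW.alt, map_zero]
  skew a b := by rw [hW.skew, map_neg]
  rel a b c d := by simp only [← map_mul, ← map_sub, ← map_add, hW.rel, map_zero]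
  norm := by rw [← map_sum, hW.norm, map_one]

lemma smul_eq (hW : IsPlucker s t W) (a b : κ) {x : κ → R} (hx : x ∈ rowSpan W) :
    W a b • x = x b • W a - x a • W b := by
  let lhs : (κ → R) →ₗ[R] (κ → R) := W a b • LinearMap.id
  let rhs : (κ → R) →ₗ[R] (κ → R) :=
    (LinearMap.proj b).smulRight (W a) - (LinearMap.proj a).smulRight (W b)
  refine LinearMap.eqOn_span (f := lhs) (g := rhs) ?_ hx
  rintro _ ⟨c, rfl⟩
  ext d
  simp only [lhs, rhs, LinearMap.smul_apply, LinearMap.id_apply, LinearMap.sub_apply,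
    LinearMap.smulRight_apply, LinearMap.proj_apply, Pi.smul_apply, Pi.sub_apply, smul_eq_mul]
  rw [hW.skew c b, hW.skew c a]
  linear_combination hW.rel a b c d

lemma pairingForm_rows (hW : IsPlucker s t W) (a b : κ) : pairingForm s t (W a) (W b) = W a b := by
  calc pairingForm s t (W a) (W b) = ∑ j, W a b * W (s j) (t j) := by
        rw [pairingForm_apply]
        exact Finset.sum_congr rfl fun j _ => by linear_combination - hW.rel a b (s j) (t j)
    _ = W a b := by rw [← Finset.mul_sum, hW.norm, mul_one]

lemma sum_smul_rows (hW : IsPlucker s t W) {x : κ → R} (hx : x ∈ rowSpan W) :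
    ∑ j, (x (t j) • W (s j) - x (s j) • W (t j)) = x := by
  simp only [← hW.smul_eq _ _ hx]
  rw [← Finset.sum_smul, hW.norm, one_smul]

lemma pairingForm_row_right (hW : IsPlucker s t W) {x : κ → R} (hx : x ∈ rowSpan W) (a : κ) :
    pairingForm s t x (W a) = x a := by
  calc pairingForm s t x (W a) = ∑ j, (x (t j) • W (s j) - x (s j) • W (t j)) a := by
        rw [pairingForm_apply]
        refine Finset.sum_congr rfl fun j _ => ?_
        rw [hW.skew a, hW.skew a, Pi.sub_apply, Pi.smul_apply, Pi.smul_apply, smul_eq_mul,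
          smul_eq_mul]
        ring
    _ = x a := by rw [← Finset.sum_apply, hW.sum_smul_rows hx]

lemma exists_notMem (hW : IsPlucker s t W) (p : PrimeSpectrum R) :
    ∃ j, W (s j) (t j) ∉ p.asIdeal := by
  by_contra! h
  exact p.isPrime.ne_top (p.asIdeal.eq_top_iff_one.2 (hW.norm ▸ Ideal.sum_mem _ fun j _ => h j))

lemma rankAtStalk_rowSpan (hW : IsPlucker s t W) (p : PrimeSpectrum R) :
    Module.rankAtStalk (R := R) (rowSpan W) p = 2 := by
  have : Nontrivial R := p.nontrivial
  obtain ⟨j, hj⟩ := hW.exists_notMem p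
  let row (a : κ) : rowSpan W := ⟨W a, row_mem_rowSpan W a⟩
  let coords : rowSpan W →ₗ[R] Fin 2 → R :=
    LinearMap.pi ![LinearMap.proj (t j) ∘ₗ Submodule.subtype _,
      - (LinearMap.proj (s j) ∘ₗ Submodule.subtype _)]
  let combination : (Fin 2 → R) →ₗ[R] rowSpan W :=
    (LinearMap.proj 0).smulRight (row (s j)) + (LinearMap.proj 1).smulRight (row (t j))
  have h₁ : coords ∘ₗ combination = W (s j) (t j) • LinearMap.id := by
    refine LinearMap.ext fun x => funext fun i => ?_
    fin_cases i
    · simp [coords, combination, row, hW.alt, mul_comm]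
    · simp [coords, combination, row, hW.alt, mul_comm, hW.skew (t j) (s j)]
  have h₂ : combination ∘ₗ coords = W (s j) (t j) • LinearMap.id := by
    refine LinearMap.ext fun x => Subtype.ext ?_
    simpa [coords, combination, row, sub_eq_add_neg] using (hW.smul_eq _ _ x.2).symm
  rw [rankAtStalk_eq_of_comp_eq_smul hj h₁ h₂]
  simp

lemma isSubbundle [Finite κ] (hW : IsPlucker s t W) : IsSubbundle 2 (rowSpan W) := by
  let projection : (κ → R) →ₗ[R] (κ → R) := ∑ j, ((LinearMap.proj (t j)).smulRight (W (s j)) -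
    (LinearMap.proj (s j)).smulRight (W (t j)))
  have hmem (x : κ → R) : projection x ∈ rowSpan W := by
    simp only [projection, LinearMap.sum_apply, LinearMap.sub_apply, LinearMap.smulRight_apply]
    exact Submodule.sum_mem _ fun j _ => Submodule.sub_mem _
      (Submodule.smul_mem _ _ (row_mem_rowSpan W _)) (Submodule.smul_mem _ _ (row_mem_rowSpan W _))
  rw [← (rowSpan W).range_subtype]
  refine isSubbundle_range hW.rankAtStalk_rowSpan (q := projection.codRestrict _ hmem) ?_
  refine LinearMap.ext fun x => Subtype.ext ?_
  simpa [projection] using hW.sum_smul_rows x.2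

lemma eq_of_rowSpan_eq (hW : IsPlucker s t W) (hW' : IsPlucker s t W')
    (h : rowSpan W = rowSpan W') : W = W' := by
  ext a b
  have h' : W' b a = -W a b :=
    calc W' b a = pairingForm s t (W' b) (W a) :=
          (hW.pairingForm_row_right (h ▸ row_mem_rowSpan W' b) a).symm
      _ = -pairingForm s t (W a) (W' b) := ((isAlt_pairingForm s t).neg_eq _ _).symm
      _ = -W a b := by rw [hW'.pairingForm_row_right (h ▸ row_mem_rowSpan W a)]
  rw [hW'.skew, h', neg_neg]

lemma exists_wedge [Finite κ] (hW : IsPlucker s t W) {f : κ}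
    (hf : Ideal.span (Set.range fun c => W c f) = ⊤) :
    ∃ u v : κ → R, u f = 0 ∧ v f = 1 ∧ pairingForm s t u v = 1 ∧
      ∀ a b, W a b = u a * v b - v a * u b := by
  have := Fintype.ofFinite κ
  obtain ⟨e, he⟩ := Ideal.mem_span_range_iff_exists_fun.1 ((Ideal.eq_top_iff_one _).1 hf)
  let u (a : κ) : R := W a f
  let v (b : κ) : R := ∑ c, e c * W c b
  have hwedge (a b : κ) : W a b = u a * v b - v a * u b :=
    calc W a b = ∑ c, W a b * (e c * W c f) := by rw [← Finset.mul_sum, he, mul_one]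
      _ = ∑ c, (W a f * (e c * W c b) - e c * W c a * W b f) :=
        Finset.sum_congr rfl fun c _ => by
          rw [hW.skew c b, hW.skew c a]
          linear_combination e c * hW.rel a b c f
      _ = u a * v b - v a * u b := by
        rw [Finset.sum_sub_distrib, ← Finset.mul_sum, ← Finset.sum_mul]
  refine ⟨u, v, hW.alt f, he, ?_, hwedge⟩
  simp only [← hW.norm, pairingForm_apply, hwedge, mul_comm]

end IsPlucker

/-- All `3 × 3` minors of vectors of `M` vanish, i.e. `M` has rank at most `2`. -/
def MinorsVanish (M : Submodule R (κ → R)) : Prop :=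
  ∀ x ∈ M, ∀ y ∈ M, ∀ z ∈ M, ∀ a b c,
    (x a * y b - x b * y a) * z c - (x a * y c - x c * y a) * z b
      + (x b * y c - x c * y b) * z a = 0

lemma IsSubbundle.minorsVanish [Finite κ] {M : Submodule R (κ → R)} (h : IsSubbundle 2 M) :
    MinorsVanish M := by
  intro x hx y hy z hz a b c
  refine eq_zero_of_forall_localization fun p => ?_
  obtain ⟨e, he⟩ := h.exists_local_generators p
  obtain ⟨cx, hx⟩ := he x hx
  obtain ⟨cy, hy⟩ := he y hy
  obtain ⟨cz, hz⟩ := he z hz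
  simp only [map_add, map_sub, map_mul, hx, hy, hz, Fin.sum_univ_two]
  ring

/-- The alternating matrices with rows in `M` that are annihilated by the wedge product with every
vector of `M`. For `M` of rank `2` this is `Λ²M`. -/
def bivectors (M : Submodule R (κ → R)) : Submodule R (κ → κ → R) where
  carrier := {W | (∀ a, W a a = 0) ∧ (∀ a b, W a b = -W b a) ∧ (∀ a, W a ∈ M) ∧
    ∀ z ∈ M, ∀ a b c, W a b * z c - W a c * z b + W b c * z a = 0}
  zero_mem' := by simp
  add_mem' := by
    rintro W W' ⟨halt, hskew, hrow, hwedge⟩ ⟨halt', hskew', hrow', hwedge'⟩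
    refine ⟨fun a => ?_, fun a b => ?_, fun a => M.add_mem (hrow a) (hrow' a), fun z hz a b c => ?_⟩
    · simp only [Pi.add_apply, halt, halt', add_zero]
    · simp only [Pi.add_apply]
      linear_combination hskew a b + hskew' a b
    · simp only [Pi.add_apply]
      linear_combination hwedge z hz a b c + hwedge' z hz a b c
  smul_mem' := by
    rintro r W ⟨halt, hskew, hrow, hwedge⟩
    refine ⟨fun a => ?_, fun a b => ?_, fun a => M.smul_mem r (hrow a), fun z hz a b c => ?_⟩
    · simp only [Pi.smul_apply, halt, smul_zero]
    · simp only [Pi.smul_apply, smul_eq_mul]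
      linear_combination r * hskew a b
    · simp only [Pi.smul_apply, smul_eq_mul]
      linear_combination r * hwedge z hz a b c

lemma MinorsVanish.wedge_mem_bivectors {M : Submodule R (κ → R)} (h : MinorsVanish M) {x y : κ → R}
    (hx : x ∈ M) (hy : y ∈ M) : (fun a b => x a * y b - x b * y a) ∈ bivectors M := by
  refine ⟨fun a => by ring, fun a b => by ring, fun a => ?_, fun z hz => h x hx y hy z hz⟩
  convert M.sub_mem (M.smul_mem (x a) hy) (M.smul_mem (y a) hx) using 1
  ext b
  simp [mul_comm]

lemma isPlucker_of_mem_bivectors {M : Submodule R (κ → R)} (hW : W ∈ bivectors M)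
    (hnorm : ∑ j, W (s j) (t j) = 1) : IsPlucker s t W := by
  obtain ⟨halt, hskew, hrow, hwedge⟩ := hW
  refine ⟨halt, hskew, fun a b c d => ?_, hnorm⟩
  have h := hwedge _ (hrow d) a b c
  rw [hskew d c, hskew d b, hskew d a] at h
  linear_combination -h

lemma rowSpan_eq_of_mem_bivectors {M : Submodule R (κ → R)} (hW : W ∈ bivectors M)
    (hnorm : ∑ j, W (s j) (t j) = 1) : rowSpan W = M := by
  obtain ⟨-, -, hrow, hwedge⟩ := hW
  refine le_antisymm (Submodule.span_le.2 (Set.range_subset_iff.2 hrow)) fun z hz => ?_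
  have hz' : z = ∑ j, (z (t j) • W (s j) - z (s j) • W (t j)) :=
    calc z = ∑ j, W (s j) (t j) • z := by rw [← Finset.sum_smul, hnorm, one_smul]
      _ = _ := by
        refine Finset.sum_congr rfl fun j _ => funext fun c => ?_
        simp only [Pi.smul_apply, smul_eq_mul, Pi.sub_apply]
        linear_combination hwedge z hz (s j) (t j) c
  rw [hz']
  exact Submodule.sum_mem _ fun j _ => Submodule.sub_mem _
    (Submodule.smul_mem _ _ (row_mem_rowSpan W _)) (Submodule.smul_mem _ _ (row_mem_rowSpan W _))

variable (s t) in
/-- The ideal generated by the values of `pairingForm s t` on `M`. It is the unit ideal iff the form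
vanishes identically on no fibre of `M`. -/
def valueIdeal (M : Submodule R (κ → R)) : Ideal R := Submodule.map₂ (pairingForm s t) M M

lemma IsPlucker.valueIdeal_eq_top (hW : IsPlucker s t W) : valueIdeal s t (rowSpan W) = ⊤ := by
  rw [Ideal.eq_top_iff_one, ← hW.norm]
  refine Ideal.sum_mem _ fun j _ => ?_
  rw [← hW.pairingForm_rows]
  exact Submodule.apply_mem_map₂ _ (row_mem_rowSpan W (s j)) (row_mem_rowSpan W (t j))

lemma valueIdeal_pullback (g : R →+* R') (M : Submodule R (κ → R)) :
    valueIdeal s t (pullbackSub g M) = (valueIdeal s t M).map g := by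
  rw [valueIdeal, pullbackSub, Submodule.map₂_span_span, valueIdeal, Submodule.map₂_eq_span_image2]
  refine .trans ?_ (Ideal.map_span g _).symm
  rw [Set.image_image2, Set.image2_image_left, Set.image2_image_right]
  simp only [pairingForm_map]

lemma MinorsVanish.exists_isPlucker {M : Submodule R (κ → R)} (h : MinorsVanish M)
    (hM : valueIdeal s t M = ⊤) : ∃ W, IsPlucker s t W ∧ rowSpan W = M := by
  let contraction : (κ → κ → R) →ₗ[R] R := ∑ j, LinearMap.proj (t j) ∘ₗ LinearMap.proj (s j)
  have hle : valueIdeal s t M ≤ (bivectors M).map contraction := by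
    refine Submodule.map₂_le.2 fun x hx y hy => ⟨_, h.wedge_mem_bivectors hx hy, ?_⟩
    simp [contraction, pairingForm_apply]
  obtain ⟨W, hW, hnorm⟩ := hle (hM ▸ Submodule.mem_top : (1 : R) ∈ valueIdeal s t M)
  have hnorm : ∑ j, W (s j) (t j) = 1 := by simpa [contraction] using hnorm
  exact ⟨W, isPlucker_of_mem_bivectors hW hnorm, rowSpan_eq_of_mem_bivectors hW hnorm⟩

end Plucker

/-! ### Plücker coordinates on the strata -/

section HPPoints

variable {R : Type u} [CommRing R]

section PerfectPairing

variable {κ J : Type} [Finite κ] [Fintype J] {s t : J → κ}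

lemma IsPlucker.isPerfPair {W : κ → κ → R} (hW : IsPlucker s t W) :
    ((pairingForm s t).domRestrict₁₂ (rowSpan W) (rowSpan W)).IsPerfPair := by
  have := hW.isSubbundle.finite
  have := hW.isSubbundle.projective
  let row (a : κ) : rowSpan W := ⟨W a, row_mem_rowSpan W a⟩
  refine .of_bijective _ ⟨(injective_iff_map_eq_zero _).2 fun x hx => ?_, fun f => ?_⟩
  · ext a
    rw [← hW.pairingForm_row_right x.2]
    exact LinearMap.congr_fun hx (row a)
  · refine ⟨∑ j, (f (row (t j)) • row (s j) - f (row (s j)) • row (t j)), LinearMap.ext fun x => ?_⟩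
    have hx : ∑ j, (x.1 (t j) • row (s j) - x.1 (s j) • row (t j)) = x :=
      Subtype.ext (by simpa [row] using hW.sum_smul_rows x.2)
    have hrow (a : κ) : pairingForm s t (W a) x = -x.1 a := by
      rw [← hW.pairingForm_row_right x.2, (isAlt_pairingForm s t).neg_eq]
    conv_rhs => rw [← hx]
    simp only [map_sum, map_sub, map_smul, LinearMap.sum_apply, LinearMap.sub_apply,
      LinearMap.smul_apply, LinearMap.domRestrict₁₂_apply, row, hrow, smul_eq_mul]
    exact Finset.sum_congr rfl fun j _ => by ring

lemma IsSubbundle.exists_coord_notMem {r : ℕ} {U : Submodule R (κ → R)} (hU : IsSubbundle r U)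
    (hr : r ≠ 0) (m : Ideal R) [hm : m.IsPrime] : ∃ x ∈ U, ∃ a, x a ∉ m := by
  by_contra! hcoord
  classical
  have := Fintype.ofFinite κ
  have := hU.finite
  obtain ⟨q, hq⟩ := hU.exists_retraction
  have hle : (⊤ : Submodule R U) ≤ m • ⊤ := fun x _ => by
    rw [← LinearMap.id_apply (R := R) x, ← hq, LinearMap.comp_apply, U.subtype_apply,
      pi_eq_sum_univ x.1, map_sum]
    refine Submodule.sum_mem _ fun a _ => ?_
    rw [map_smul]
    exact Submodule.smul_mem_smul (hcoord x.1 x.2 a) trivial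
  obtain ⟨c, hc, hcU⟩ := Submodule.exists_sub_one_mem_and_smul_eq_zero_of_fg_of_le_smul m ⊤
    Module.Finite.fg_top hle
  have hcm : c ∉ m := fun h => hm.ne_top (m.eq_top_iff_one.2 (by simpa using m.sub_mem h hc))
  have hrank := rankAtStalk_eq_of_comp_eq_smul (M := U) (N := PUnit) (p := ⟨m, hm⟩) hcm (f := 0)
    (h := 0) (Subsingleton.elim _ _) (LinearMap.ext fun x => (hcU x trivial).symm)
  rw [hU.rank_eq] at hrank
  simp [hr] at hrank

lemma IsSubbundle.valueIdeal_eq_top {r : ℕ} {U : Submodule R (κ → R)} (hU : IsSubbundle r U)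
    (hr : r ≠ 0) (h : ((pairingForm s t).domRestrict₁₂ U U).IsPerfPair) :
    valueIdeal s t U = ⊤ := by
  by_contra hne
  obtain ⟨m, hm, hle⟩ := Ideal.exists_le_maximal _ hne
  obtain ⟨x, hx, a, ha⟩ := hU.exists_coord_notMem hr m
  obtain ⟨y, hy⟩ := h.bijective_left.2 (LinearMap.proj a ∘ₗ U.subtype)
  have hxa : pairingForm s t y.1 x = x a := LinearMap.congr_fun hy ⟨x, hx⟩
  exact ha (hle (hxa ▸ Submodule.apply_mem_map₂ _ y.2 hx))

end PerfectPairing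

lemma stdForm_eq_pairingForm (m : ℕ) : stdForm R m = pairingForm (·, 0) (·, 1) := by
  refine LinearMap.ext₂ fun x y => ?_
  rw [pairingForm_apply]
  rfl

variable {n i : ℕ} {U : Submodule R (Fin (n + 1) × Fin 2 → R)}

lemma mem_hpPoints : U ∈ hpPoints R n ↔ ∃ W, IsPlucker (·, 0) (·, 1) W ∧ rowSpan W = U := by
  rw [hpPoints, Set.mem_ofPred_eq, stdForm_eq_pairingForm]
  constructor
  · rintro ⟨hU, hpair⟩
    exact hU.minorsVanish.exists_isPlucker (hU.valueIdeal_eq_top two_ne_zero hpair)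
  · rintro ⟨W, hW, rfl⟩
    exact ⟨hW.isSubbundle, hW.isPerfPair⟩

lemma mem_flagEPerp {m : ℕ} {x : Fin m × Fin 2 → R} :
    x ∈ flagEPerp R m i ↔ ∀ j : Fin m, (j : ℕ) < i → x (j, 1) = 0 := by
  have hbasis (j : Fin m) : stdForm R m (Pi.single (j, 0) 1) x = x (j, 1) := by
    rw [stdForm_eq_pairingForm, pairingForm_apply, Finset.sum_eq_single j]
    · simp
    · intro b _ hb
      simp [hb]
    · simp
  constructor
  · intro hx j hj
    rw [← hbasis j]
    exact hx _ (Submodule.subset_span ⟨j, hj, rfl⟩)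
  · intro hx y hy
    have hle : flagE R m i ≤ LinearMap.ker ((stdForm R m).flip x) := Submodule.span_le.2 <| by
      rintro _ ⟨j, hj, rfl⟩
      exact (hbasis j).trans (hx j hj)
    exact hle hy

lemma rowSpan_le_flagEPerp {m : ℕ} {W : Fin m × Fin 2 → Fin m × Fin 2 → R} :
    rowSpan W ≤ flagEPerp R m i ↔ ∀ j : Fin m, (j : ℕ) < i → ∀ a, W a (j, 1) = 0 := by
  simp only [rowSpan, Submodule.span_le, Set.range_subset_iff, SetLike.mem_coe, mem_flagEPerp]
  exact ⟨fun h j hj a => h a j hj, fun h a j hj => h j hj a⟩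

lemma mem_closedStratumPoints :
    U ∈ closedStratumPoints R n i ↔ ∃ W, IsPlucker (·, 0) (·, 1) W ∧
      (∀ j : Fin (n + 1), (j : ℕ) < i → ∀ a, W a (j, 1) = 0) ∧ rowSpan W = U := by
  rw [closedStratumPoints, Set.mem_ofPred_eq, mem_hpPoints]
  constructor
  · rintro ⟨⟨W, hW, rfl⟩, hle⟩
    exact ⟨W, hW, rowSpan_le_flagEPerp.1 hle, rfl⟩
  · rintro ⟨W, hW, hzero, rfl⟩
    exact ⟨⟨W, hW, rfl⟩, rowSpan_le_flagEPerp.2 hzero⟩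

lemma span_range_eq_top_iff_forall_field {ι : Type*} (v : ι → R) :
    Ideal.span (Set.range v) = ⊤ ↔ ∀ (K : Type u) [Field K] (g : R →+* K), ∃ a, g (v a) ≠ 0 := by
  constructor
  · intro h K _ g
    by_contra! hzero
    have hle : Ideal.span (Set.range v) ≤ RingHom.ker g :=
      Ideal.span_le.2 (Set.range_subset_iff.2 hzero)
    exact RingHom.ker_ne_top g (top_le_iff.1 (h ▸ hle))
  · intro h
    by_contra hne
    obtain ⟨m, hm, hle⟩ := Ideal.exists_le_maximal _ hne
    let := Ideal.Quotient.field m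
    obtain ⟨a, ha⟩ := h (R ⧸ m) (Ideal.Quotient.mk m)
    exact ha (Ideal.Quotient.eq_zero_iff_mem.2 (hle (Ideal.subset_span ⟨a, rfl⟩)))

lemma mem_stratumPoints (hi : i ≤ n) :
    U ∈ stratumPoints R n i ↔ ∃ W, IsPlucker (·, 0) (·, 1) W ∧
      (∀ j : Fin (n + 1), (j : ℕ) < i → ∀ a, W a (j, 1) = 0) ∧
      Ideal.span (Set.range fun a => W a (⟨i, by omega⟩, 1)) = ⊤ ∧ rowSpan W = U := by
  rw [stratumPoints, Set.mem_ofPred_eq, mem_closedStratumPoints]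
  simp only [span_range_eq_top_iff_forall_field]
  constructor
  · rintro ⟨⟨W, hW, hzero, rfl⟩, hopen⟩
    refine ⟨W, hW, hzero, fun K _ g => ?_, rfl⟩
    by_contra! hcol
    refine hopen K g (mem_closedStratumPoints.2 ⟨_, hW.map g, fun j hj a => ?_,
      (pullbackSub_rowSpan g W).symm⟩)
    obtain hj | hj := Nat.lt_succ_iff_lt_or_eq.1 hj
    · rw [hzero j hj, map_zero]
    · rw [show j = ⟨i, by omega⟩ from Fin.ext hj, hcol]
  · rintro ⟨W, hW, hzero, hcol, rfl⟩
    refine ⟨⟨W, hW, hzero, rfl⟩, fun K _ g hg => ?_⟩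
    obtain ⟨a, ha⟩ := hcol K g
    rw [pullbackSub_rowSpan] at hg
    exact ha (rowSpan_le_flagEPerp.1 hg.2 _ (Nat.lt_succ_self i) a)

end HPPoints

section ExtendByZero

variable {R R' : Type u} [CommRing R] [CommRing R'] {κ κ' : Type} {f : κ → κ'} {W : κ → κ → R}

/-- The extension by zero of a matrix along a map of index sets, used to regard a bivector on
`E_i^⊥` as a bivector on the whole symplectic space. -/
def extendByZero (f : κ → κ') (W : κ → κ → R) (p q : κ') : R :=
  Function.extend (Prod.map f f) (fun x => W x.1 x.2) 0 (p, q)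

lemma extendByZero_apply (hf : f.Injective) (W : κ → κ → R) (a b : κ) :
    extendByZero f W (f a) (f b) = W a b :=
  (hf.prodMap hf).extend_apply (fun x => W x.1 x.2) 0 (a, b)

lemma extendByZero_of_left_notMem_range (W : κ → κ → R) {p : κ'} (hp : p ∉ Set.range f) (q : κ') :
    extendByZero f W p q = 0 :=
  Function.extend_apply' _ _ _ fun ⟨x, hx⟩ => hp ⟨x.1, congrArg Prod.fst hx⟩

lemma extendByZero_of_right_notMem_range (W : κ → κ → R) (p : κ') {q : κ'}
    (hq : q ∉ Set.range f) : extendByZero f W p q = 0 :=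
  Function.extend_apply' _ _ _ fun ⟨x, hx⟩ => hq ⟨x.2, congrArg Prod.snd hx⟩

lemma extendByZero_map (g : R →+* R') (f : κ → κ') (W : κ → κ → R) :
    (fun p q => g (extendByZero f W p q)) = extendByZero f fun a b => g (W a b) := by
  ext p q
  rw [extendByZero, Function.apply_extend g]
  exact congrArg (Function.extend _ _ · _) (funext fun _ => map_zero g)

lemma extendByZero_injective (hf : f.Injective) :
    Function.Injective (extendByZero (R := R) f) := fun W W' h => by
  ext a b
  rw [← extendByZero_apply hf W, h, extendByZero_apply hf]

lemma extendByZero_restrict (hf : f.Injective) {V : κ' → κ' → R}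
    (hleft : ∀ p ∉ Set.range f, ∀ q, V p q = 0) (hright : ∀ p, ∀ q ∉ Set.range f, V p q = 0) :
    extendByZero f (fun a b => V (f a) (f b)) = V := by
  ext p q
  by_cases hp : p ∈ Set.range f
  · by_cases hq : q ∈ Set.range f
    · obtain ⟨⟨a, rfl⟩, b, rfl⟩ := And.intro hp hq
      rw [extendByZero_apply hf]
    · rw [extendByZero_of_right_notMem_range _ _ hq, hright p q hq]
  · rw [extendByZero_of_left_notMem_range _ hp, hleft p hp]

lemma span_range_extendByZero (hf : f.Injective) (W : κ → κ → R) (b : κ) :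
    Ideal.span (Set.range fun p => extendByZero f W p (f b)) =
      Ideal.span (Set.range fun a => W a b) := by
  refine le_antisymm (Ideal.span_le.2 ?_) (Ideal.span_mono ?_)
  · rintro _ ⟨p, rfl⟩
    by_cases hp : p ∈ Set.range f
    · obtain ⟨a, rfl⟩ := hp
      exact Ideal.subset_span ⟨a, (extendByZero_apply hf W a b).symm⟩
    · simp only [extendByZero_of_left_notMem_range W hp, SetLike.mem_coe, Ideal.zero_mem]
  · rintro _ ⟨a, rfl⟩
    exact ⟨f a, extendByZero_apply hf W a b⟩

lemma IsPlucker.extendByZero {J J' : Type} [Fintype J] [Fintype J'] {s t : J → κ} {s' t' : J' → κ'}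
    (hW : IsPlucker s t W) (hf : f.Injective)
    (hnorm : ∑ j, extendByZero f W (s' j) (t' j) = ∑ j, W (s j) (t j)) :
    IsPlucker s' t' (extendByZero f W) := by
  have hleft (p q) (hp : p ∉ Set.range f) := extendByZero_of_left_notMem_range W hp q
  have hright (p q) (hq : q ∉ Set.range f) := extendByZero_of_right_notMem_range W p hq
  refine ⟨fun p => ?_, fun p q => ?_, fun p q r z => ?_, hnorm.trans hW.norm⟩
  · by_cases hp : p ∈ Set.range f
    · obtain ⟨a, rfl⟩ := hp
      rw [extendByZero_apply hf, hW.alt]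
    · exact hleft _ _ hp
  · by_cases hp : p ∈ Set.range f
    · by_cases hq : q ∈ Set.range f
      · obtain ⟨⟨a, rfl⟩, b, rfl⟩ := And.intro hp hq
        rw [extendByZero_apply hf, extendByZero_apply hf, hW.skew]
      · rw [hright _ _ hq, hleft _ _ hq, neg_zero]
    · rw [hleft _ _ hp, hright _ _ hp, neg_zero]
  · by_cases hp : p ∈ Set.range f
    swap; · simp [hleft _ _ hp]
    by_cases hq : q ∈ Set.range f
    swap; · simp [hleft _ _ hq, hright _ _ hq]
    by_cases hr : r ∈ Set.range f
    swap; · simp [hleft _ _ hr, hright _ _ hr]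
    by_cases hz : z ∈ Set.range f
    swap; · simp [hright _ _ hz]
    obtain ⟨⟨a, rfl⟩, ⟨b, rfl⟩, ⟨c, rfl⟩, d, rfl⟩ := And.intro hp (And.intro hq (And.intro hr hz))
    simp only [extendByZero_apply hf, hW.rel]

end ExtendByZero

section StratumIndex

variable {R : Type u} [CommRing R]

/-- The coordinates of `E_i^⊥`: `e_j` for `j ≤ i`, and all `e_j`, `f_j` for `j > i`, where the
index `none` stands for the hyperbolic plane `⟨e_{i+1}, f_{i+1}⟩`. -/
abbrev PerpIdx (n i : ℕ) : Type := Fin i ⊕ (Option (Fin (n - i)) × Fin 2)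

/-- The index of `e_j`. -/
abbrev perpSrc (n i : ℕ) (j : Option (Fin (n - i))) : PerpIdx n i := .inr (j, 0)

/-- The index of `f_j`. -/
abbrev perpTgt (n i : ℕ) (j : Option (Fin (n - i))) : PerpIdx n i := .inr (j, 1)

variable {n i : ℕ} (hi : i ≤ n)

/-- The position of a hyperbolic plane among all of them. -/
def posEquiv : Fin i ⊕ Option (Fin (n - i)) ≃ Fin (n + 1) :=
  ((Equiv.refl _).sumCongr (finSuccEquiv (n - i)).symm).trans
    (finSumFinEquiv.trans (finCongr (by omega)))

lemma posEquiv_inl (j : Fin i) : (posEquiv hi (.inl j) : ℕ) = j := by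
  simp [posEquiv]

lemma le_posEquiv_inr (j : Option (Fin (n - i))) : i ≤ (posEquiv hi (.inr j) : ℕ) := by
  simp [posEquiv]

lemma posEquiv_none : posEquiv hi (.inr none) = ⟨i, by omega⟩ := by
  ext
  simp [posEquiv]

/-- The inclusion of the coordinates of `E_i^⊥` in all coordinates. -/
def perpEmb : PerpIdx n i → Fin (n + 1) × Fin 2 :=
  Sum.elim (fun j => (posEquiv hi (.inl j), 0)) fun p => (posEquiv hi (.inr p.1), p.2)

lemma perpEmb_injective : Function.Injective (perpEmb hi) := by
  rintro (a | ⟨a, b⟩) (c | ⟨c, d⟩) h <;> simp_all [perpEmb]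

lemma notMem_range_perpEmb {p : Fin (n + 1) × Fin 2} :
    p ∉ Set.range (perpEmb hi) ↔ (p.1 : ℕ) < i ∧ p.2 = 1 := by
  obtain ⟨p, e⟩ := p
  obtain ⟨j | j, rfl⟩ := (posEquiv hi).surjective p
  · have hlt : (posEquiv hi (.inl j) : ℕ) < i := by rw [posEquiv_inl]; exact j.2
    fin_cases e
    · simp [perpEmb]
    · simp [perpEmb, hlt]
  · exact iff_of_false (not_not.2 ⟨.inr (j, e), rfl⟩) fun h => (le_posEquiv_inr hi j).not_gt h.1

lemma sum_extendByZero_perpEmb (W : PerpIdx n i → PerpIdx n i → R) :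
    ∑ j, extendByZero (perpEmb hi) W (j, 0) (j, 1) = ∑ j, W (perpSrc n i j) (perpTgt n i j) := by
  rw [← (posEquiv hi).sum_comp, Fintype.sum_sum_type, Finset.sum_eq_zero, zero_add]
  · exact Finset.sum_congr rfl fun j _ =>
      extendByZero_apply (perpEmb_injective hi) W (perpSrc n i j) (perpTgt n i j)
  · intro j _
    refine extendByZero_of_right_notMem_range W _ ((notMem_range_perpEmb hi).2 ⟨?_, rfl⟩)
    simp [posEquiv_inl]

lemma span_range_extendByZero_perpEmb (W : PerpIdx n i → PerpIdx n i → R) :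
    Ideal.span (Set.range fun p => extendByZero (perpEmb hi) W p (⟨i, by omega⟩, 1)) =
      Ideal.span (Set.range fun a => W a (perpTgt n i none)) := by
  rw [← span_range_extendByZero (perpEmb_injective hi), perpEmb, Sum.elim_inr, posEquiv_none]

lemma mem_stratumPoints_iff_exists_perp {U : Submodule R (Fin (n + 1) × Fin 2 → R)} :
    U ∈ stratumPoints R n i ↔ ∃ W, IsPlucker (perpSrc n i) (perpTgt n i) W ∧
      Ideal.span (Set.range fun a => W a (perpTgt n i none)) = ⊤ ∧
      rowSpan (extendByZero (perpEmb hi) W) = U := by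
  rw [mem_stratumPoints hi]
  constructor
  · rintro ⟨V, hV, hzero, hcol, rfl⟩
    have hright (p q) (hq : q ∉ Set.range (perpEmb hi)) : V p q = 0 := by
      obtain ⟨q, e⟩ := q
      obtain ⟨hq, rfl⟩ := (notMem_range_perpEmb hi).1 hq
      exact hzero q hq p
    obtain ⟨W, hW⟩ : ∃ W, extendByZero (perpEmb hi) W = V :=
      ⟨_, extendByZero_restrict (perpEmb_injective hi)
        (fun p hp q => by rw [hV.skew, hright q p hp, neg_zero]) hright⟩
    have happly (a b) : W a b = V (perpEmb hi a) (perpEmb hi b) := by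
      rw [← hW, extendByZero_apply (perpEmb_injective hi)]
    refine ⟨W, ⟨fun a => ?_, fun a b => ?_, fun a b c d => ?_, ?_⟩, ?_, by rw [hW]⟩
    · rw [happly, hV.alt]
    · rw [happly, happly, hV.skew]
    · simp only [happly, hV.rel]
    · rw [← sum_extendByZero_perpEmb hi, hW, hV.norm]
    · rw [← span_range_extendByZero_perpEmb hi, hW, hcol]
  · rintro ⟨W, hW, hcol, rfl⟩
    exact ⟨_, hW.extendByZero (perpEmb_injective hi) (sum_extendByZero_perpEmb hi W),
      fun _ hj _ => extendByZero_of_right_notMem_range W _ ((notMem_range_perpEmb hi).2 ⟨hj, rfl⟩),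
      (span_range_extendByZero_perpEmb hi W).trans hcol, rfl⟩

end StratumIndex

/-! ### The affine space covering a stratum -/

section Cell

variable {R : Type u} [CommRing R] {n i : ℕ}

lemma eq_add_smul_of_wedge_eq {κ J : Type} [Fintype J] {s t : J → κ} {u v v' : κ → R}
    (huv : pairingForm s t u v = 1)
    (h : ∀ a b, u a * v b - v a * u b = u a * v' b - v' a * u b) :
    v' = v + pairingForm s t v' v • u := by
  ext b
  have hprop : (v' - v) b • u = u b • (v' - v) := by
    ext a
    simp only [Pi.smul_apply, Pi.sub_apply, smul_eq_mul]
    linear_combination - h a b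
  have hcoeff := congrArg (pairingForm s t · v) hprop
  simp only [map_smul, LinearMap.smul_apply, huv, map_sub, LinearMap.sub_apply,
    (isAlt_pairingForm s t).self_eq_zero, sub_zero, Pi.sub_apply, smul_eq_mul, mul_one] at hcoeff
  rw [Pi.add_apply, Pi.smul_apply, smul_eq_mul]
  linear_combination hcoeff

/-- The vector `u = (α, 1 - φ(a, b), 0, a)` of the symplectic basis `u`, `v` attached to a point. -/
def cellU (x : CellIdx.{u} n i → R) : PerpIdx n i → R
  | .inl j => x ⟨.inl j⟩
  | .inr (some j, e) => x ⟨.inr (.inl (j, e))⟩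
  | .inr (none, 0) => 1 - stdForm R (n - i) (fun j => x ⟨.inr (.inl j)⟩)
      (fun j => x ⟨.inr (.inr (.inr (.inl j)))⟩)
  | .inr (none, 1) => 0

/-- The vector `v = (β, r, 1, b)` of the symplectic basis `u`, `v` attached to a point. -/
def cellV (x : CellIdx.{u} n i → R) : PerpIdx n i → R
  | .inl j => x ⟨.inr (.inr (.inl j))⟩
  | .inr (some j, e) => x ⟨.inr (.inr (.inr (.inl (j, e))))⟩
  | .inr (none, 0) => x ⟨.inr (.inr (.inr (.inr ())))⟩
  | .inr (none, 1) => 1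

lemma pairingForm_perp (u v : PerpIdx n i → R) : pairingForm (perpSrc n i) (perpTgt n i) u v =
    u (perpSrc n i none) * v (perpTgt n i none) - u (perpTgt n i none) * v (perpSrc n i none) +
      stdForm R (n - i) (fun j => u (.inr (some j.1, j.2)))
        (fun j => v (.inr (some j.1, j.2))) := by
  rw [pairingForm_apply, Fintype.sum_option]
  rfl

lemma pairingForm_cell (x : CellIdx.{u} n i → R) :
    pairingForm (perpSrc n i) (perpTgt n i) (cellU x) (cellV x) = 1 := by
  rw [pairingForm_perp]
  simp [cellU, cellV]

lemma exists_cellU_eq_and_cellV_eq {u v : PerpIdx n i → R} (hu : u (perpTgt n i none) = 0)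
    (hv : v (perpTgt n i none) = 1) (h : pairingForm (perpSrc n i) (perpTgt n i) u v = 1) :
    ∃ x : CellIdx.{u} n i → R, cellU x = u ∧ cellV x = v := by
  refine ⟨fun c => match c with
    | ⟨.inl j⟩ => u (.inl j)
    | ⟨.inr (.inl j)⟩ => u (.inr (some j.1, j.2))
    | ⟨.inr (.inr (.inl j))⟩ => v (.inl j)
    | ⟨.inr (.inr (.inr (.inl j)))⟩ => v (.inr (some j.1, j.2))
    | ⟨.inr (.inr (.inr (.inr ())))⟩ => v (.inr (none, 0)), ?_, ?_⟩
  · rw [pairingForm_perp, hu, hv] at h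
    ext (j | ⟨_ | j, e⟩)
    · rfl
    · fin_cases e
      · change 1 - stdForm R (n - i) _ _ = u (.inr (none, 0))
        linear_combination -h
      · exact hu.symm
    · rfl
  · ext (j | ⟨_ | j, e⟩)
    · rfl
    · fin_cases e
      · rfl
      · exact hv.symm
    · rfl

lemma cell_ext {x y : CellIdx.{u} n i → R} (hu : cellU x = cellU y) (hv : cellV x = cellV y) :
    x = y := by
  ext ⟨j | j | j | j | _⟩
  · exact congrFun hu (.inl j)
  · exact congrFun hu (.inr (some j.1, j.2))
  · exact congrFun hv (.inl j)
  · exact congrFun hv (.inr (some j.1, j.2))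
  · exact congrFun hv (.inr (none, 0))

lemma cellU_cellFormula (t : R) (x : CellIdx.{u} n i → R) :
    cellU (cellFormula n i t x) = cellU x := by
  ext (j | ⟨_ | j, e⟩)
  · rfl
  · fin_cases e
    · let a (j : Fin (n - i) × Fin 2) : R := x ⟨.inr (.inl j)⟩
      let b (j : Fin (n - i) × Fin 2) : R := x ⟨.inr (.inr (.inr (.inl j)))⟩
      have ha : stdForm R (n - i) a a = 0 := by
        rw [stdForm_eq_pairingForm, (isAlt_pairingForm _ _).self_eq_zero]
      change 1 - stdForm R (n - i) a (b + t • a) = 1 - stdForm R (n - i) a b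
      rw [map_add, map_smul, ha, smul_zero, add_zero]
    · rfl
  · rfl

lemma cellV_cellFormula (t : R) (x : CellIdx.{u} n i → R) :
    cellV (cellFormula n i t x) = cellV x + t • cellU x := by
  ext (j | ⟨_ | j, e⟩)
  · rfl
  · fin_cases e
    · rfl
    · simp [cellU, cellV]
  · rfl

lemma cellFormula_zero (x : CellIdx.{u} n i → R) : cellFormula n i 0 x = x :=
  cell_ext (cellU_cellFormula _ _) (by rw [cellV_cellFormula, zero_smul, add_zero])

lemma cellFormula_add (s t : R) (x : CellIdx.{u} n i → R) :
    cellFormula n i (s + t) x = cellFormula n i s (cellFormula n i t x) :=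
  cell_ext (by simp only [cellU_cellFormula])
    (by simp only [cellV_cellFormula, cellU_cellFormula]; module)

lemma cellFormula_left_injective (x : CellIdx.{u} n i → R) :
    Function.Injective fun t => cellFormula n i t x := by
  refine Function.LeftInverse.injective
    (g := fun y => pairingForm (perpSrc n i) (perpTgt n i) (cellV y) (cellV x)) fun t => ?_
  beta_reduce
  rw [cellV_cellFormula, map_add, LinearMap.add_apply, (isAlt_pairingForm _ _).self_eq_zero,
    map_smul, LinearMap.smul_apply, pairingForm_cell, zero_add, smul_eq_mul, mul_one]

/-- The Plücker coordinates of the plane spanned by `u` and `v`. -/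
def cellW (x : CellIdx.{u} n i → R) (a b : PerpIdx n i) : R :=
  cellU x a * cellV x b - cellV x a * cellU x b

lemma isPlucker_cellW (x : CellIdx.{u} n i → R) :
    IsPlucker (perpSrc n i) (perpTgt n i) (cellW x) :=
  isPlucker_wedge _ _ (pairingForm_cell x)

lemma cellW_perpTgt_none (x : CellIdx.{u} n i → R) (a : PerpIdx n i) :
    cellW x a (perpTgt n i none) = cellU x a := by
  simp [cellW, cellU, cellV]

lemma span_range_cellU (x : CellIdx.{u} n i → R) : Ideal.span (Set.range (cellU x)) = ⊤ := by
  rw [Ideal.eq_top_iff_one, ← pairingForm_cell x, pairingForm_apply]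
  have hmem (a : PerpIdx n i) : cellU x a ∈ Ideal.span (Set.range (cellU x)) :=
    Ideal.subset_span ⟨a, rfl⟩
  exact Ideal.sum_mem _ fun j _ =>
    Ideal.sub_mem _ (Ideal.mul_mem_right _ _ (hmem _)) (Ideal.mul_mem_right _ _ (hmem _))

lemma cellW_cellFormula (t : R) (x : CellIdx.{u} n i → R) :
    cellW (cellFormula n i t x) = cellW x := by
  ext a b
  simp only [cellW, cellU_cellFormula, cellV_cellFormula, Pi.add_apply, Pi.smul_apply, smul_eq_mul]
  ring

lemma eq_cellFormula_of_cellW_eq {x y : CellIdx.{u} n i → R} (h : cellW x = cellW y) :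
    y = cellFormula n i (pairingForm (perpSrc n i) (perpTgt n i) (cellV y) (cellV x)) x := by
  have hu : cellU y = cellU x := by
    ext a
    rw [← cellW_perpTgt_none, ← h, cellW_perpTgt_none]
  refine cell_ext (by rw [cellU_cellFormula, hu]) ?_
  rw [cellV_cellFormula]
  refine eq_add_smul_of_wedge_eq (pairingForm_cell x) fun a b => ?_
  simpa only [cellW, hu] using congrFun₂ h a b

lemma exists_cellW_eq {W : PerpIdx n i → PerpIdx n i → R}
    (hW : IsPlucker (perpSrc n i) (perpTgt n i) W)
    (hcol : Ideal.span (Set.range fun a => W a (perpTgt n i none)) = ⊤) :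
    ∃ x : CellIdx.{u} n i → R, cellW x = W := by
  obtain ⟨u, v, hu, hv, huv, hwedge⟩ := hW.exists_wedge hcol
  obtain ⟨x, rfl, rfl⟩ := exists_cellU_eq_and_cellV_eq hu hv huv
  exact ⟨x, funext₂ fun a b => (hwedge a b).symm⟩

end Cell

section CellMap

variable {R R' : Type u} [CommRing R] [CommRing R'] (g : R →+* R') {n i : ℕ}

lemma stdForm_map (m : ℕ) (x y : Fin m × Fin 2 → R) :
    stdForm R' m (fun j => g (x j)) (fun j => g (y j)) = g (stdForm R m x y) := by
  rw [stdForm_eq_pairingForm, stdForm_eq_pairingForm, pairingForm_map]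

lemma cellU_map (x : CellIdx.{u} n i → R) :
    cellU (fun c => g (x c)) = fun a => g (cellU x a) := by
  ext (j | ⟨_ | j, e⟩)
  · rfl
  · fin_cases e
    · simp [cellU, ← stdForm_map]
    · simp [cellU]
  · rfl

lemma cellV_map (x : CellIdx.{u} n i → R) :
    cellV (fun c => g (x c)) = fun a => g (cellV x a) := by
  ext (j | ⟨_ | j, e⟩)
  · rfl
  · fin_cases e
    · rfl
    · simp [cellV]
  · rfl

lemma cellW_map (x : CellIdx.{u} n i → R) :
    cellW (fun c => g (x c)) = fun a b => g (cellW x a b) := by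
  ext a b
  simp [cellW, cellU_map, cellV_map]

lemma cellFormula_map (t : R) (x : CellIdx.{u} n i → R) :
    cellFormula n i (g t) (fun c => g (x c)) = fun c => g (cellFormula n i t x c) := by
  refine cell_ext (by simp only [cellU_cellFormula, cellU_map]) (funext fun a => ?_)
  simp only [cellV_cellFormula, cellU_map, cellV_map, Pi.add_apply, Pi.smul_apply, smul_eq_mul,
    map_add, map_mul]

end CellMap

/-! ### Morphisms determined by their effect on affine points -/

section AffinePoints

variable {k X Y : Scheme.{u}}

lemma hom_ext_affine {f g : X ⟶ Y}
    (h : ∀ {R : CommRingCat.{u}} (y : Spec R ⟶ X), y ≫ f = y ≫ g) : f = g :=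
  X.affineCover.hom_ext f g fun j => h (R := X.affineOpenCover.X j) (X.affineCover.f j)

lemma exists_hom_of_affine_points (η : ∀ {R : CommRingCat.{u}}, (Spec R ⟶ X) → (Spec R ⟶ Y))
    (hη : ∀ {R R' : CommRingCat.{u}} (g : R ⟶ R') (y : Spec R ⟶ X),
      η (Spec.map g ≫ y) = Spec.map g ≫ η y) :
    ∃ f : X ⟶ Y, ∀ {R : CommRingCat.{u}} (y : Spec R ⟶ X), y ≫ f = η y := by
  have compatible {R R' : CommRingCat.{u}} (y : Spec R ⟶ X) (y' : Spec R' ⟶ X) {T : Scheme.{u}}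
      (a : T ⟶ Spec R) (b : T ⟶ Spec R') (h : a ≫ y = b ≫ y') : a ≫ η y = b ≫ η y' := by
    refine hom_ext_affine fun z => ?_
    obtain ⟨a', ha⟩ := Spec.map_surjective (z ≫ a)
    obtain ⟨b', hb⟩ := Spec.map_surjective (z ≫ b)
    rw [← Category.assoc, ← Category.assoc, ← ha, ← hb, ← hη, ← hη, ha, hb, Category.assoc, h,
      Category.assoc]
  let 𝒰 := X.affineOpenCover
  let f : X ⟶ Y := 𝒰.openCover.glueMorphisms (fun j => η (R := 𝒰.X j) (𝒰.f j)) fun i j =>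
    compatible (R := 𝒰.X i) (R' := 𝒰.X j) (𝒰.f i) (𝒰.f j) _ _ pullback.condition
  have hf (j : 𝒰.I₀) : 𝒰.f j ≫ f = η (R := 𝒰.X j) (𝒰.f j) := 𝒰.openCover.ι_glueMorphisms _ _ j
  refine ⟨f, fun {R} y => Scheme.Cover.hom_ext (𝒰.openCover.pullback₁ y) _ _ ?_⟩
  have hlocal (j : 𝒰.I₀) :
      pullback.fst y (𝒰.f j) ≫ y ≫ f = pullback.fst y (𝒰.f j) ≫ η y := by
    rw [pullback.condition_assoc, hf]
    exact compatible (R := 𝒰.X j) _ _ _ _ pullback.condition.symm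
  exact hlocal

namespace IsStratum

variable {n i : ℕ} {X Y : Over k}

lemma exists_hom (hX : IsStratum n i X) (hY : IsStratum n i Y) : ∃ f : X ⟶ Y,
    ∀ {R : CommRingCat.{u}} (y : Spec R ⟶ X.left), hY.taut (y ≫ f.left) = hX.taut y := by
  choose η hη hη_unique using fun {R : CommRingCat.{u}} (y : Spec R ⟶ X.left) =>
    hY.existsUnique (y ≫ X.hom) (hX.taut y) (hX.taut_mem y)
  obtain ⟨f, hf⟩ := exists_hom_of_affine_points η fun g y => by
    refine (hη_unique _ _ ⟨?_, ?_⟩).symm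
    · rw [Category.assoc, (hη y).1, Category.assoc]
    · rw [hY.taut_comp, (hη y).2, hX.taut_comp]
  refine ⟨Over.homMk f (hom_ext_affine fun y => ?_), fun y => ?_⟩
  · rw [← Category.assoc, hf, (hη y).1]
  · simp only [Over.homMk_left, hf, (hη y).2]

lemma eq_id_of_taut_comp_eq (hX : IsStratum n i X) {f : X ⟶ X}
    (hf : ∀ {R : CommRingCat.{u}} (y : Spec R ⟶ X.left), hX.taut (y ≫ f.left) = hX.taut y) :
    f = 𝟙 X := by
  ext1
  refine hom_ext_affine fun y => ?_
  refine (hX.existsUnique (y ≫ X.hom) _ (hX.taut_mem y)).unique ⟨?_, hf y⟩ ⟨?_, ?_⟩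
  · rw [Category.assoc, Over.w]
  · rw [Over.id_left, Category.comp_id]
  · rw [Over.id_left, Category.comp_id]

lemma nonempty_iso (hX : IsStratum n i X) (hY : IsStratum n i Y) : Nonempty (X ≅ Y) := by
  obtain ⟨f, hf⟩ := hX.exists_hom hY
  obtain ⟨g, hg⟩ := hY.exists_hom hX
  refine ⟨⟨f, g, hX.eq_id_of_taut_comp_eq fun y => ?_, hY.eq_id_of_taut_comp_eq fun y => ?_⟩⟩
  · rw [Over.comp_left, ← Category.assoc, hg, hf]
  · rw [Over.comp_left, ← Category.assoc, hf, hg]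

end IsStratum

end AffinePoints

/-! ### The scheme of Plücker coordinates -/

section PluckerScheme

variable {R : Type u} [CommRing R] {κ J : Type} [Fintype J] (s t : J → κ)

/-- The polynomial ring in the entries of a matrix. -/
abbrev MatPoly (κ : Type) : Type u := MvPolynomial (κ × κ) (ULift.{u} ℤ)

/-- The equations for Plücker coordinates. -/
def pluckerRel : Set (MatPoly.{u} κ) :=
  {p | (∃ a, p = .X (a, a)) ∨ (∃ a b, p = .X (a, b) + .X (b, a)) ∨
    (∃ a b c d, p = .X (a, b) * .X (c, d) - .X (a, c) * .X (b, d) + .X (a, d) * .X (b, c)) ∨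
    p = ∑ j, .X (s j, t j) - 1}

lemma isPlucker_iff_forall_rel (f : MatPoly.{u} κ →+* R) :
    IsPlucker s t (fun a b => f (.X (a, b))) ↔ ∀ p ∈ pluckerRel s t, f p = 0 := by
  constructor
  · rintro h p (⟨a, rfl⟩ | ⟨a, b, rfl⟩ | ⟨a, b, c, d, rfl⟩ | rfl)
    · exact h.alt a
    · rw [map_add, h.skew a b, neg_add_cancel]
    · simpa using h.rel a b c d
    · rw [map_sub, map_sum, h.norm, map_one, sub_self]
  · intro h
    refine ⟨fun a => h _ (.inl ⟨a, rfl⟩), fun a b => ?_, fun a b c d => ?_, ?_⟩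
    · rw [← add_eq_zero_iff_eq_neg, ← map_add]
      exact h _ (.inr (.inl ⟨a, b, rfl⟩))
    · simpa using h _ (.inr (.inr (.inl ⟨a, b, c, d, rfl⟩)))
    · simpa [sub_eq_zero] using h _ (.inr (.inr (.inr rfl)))

/-- The ring representing Plücker coordinates. -/
abbrev PluckerRing : Type u := MatPoly.{u} κ ⧸ Ideal.span (pluckerRel.{u} s t)

/-- The universal Plücker coordinates. -/
def pluckerGen (a b : κ) : PluckerRing.{u} s t := Ideal.Quotient.mk _ (.X (a, b))

lemma isPlucker_pluckerGen : IsPlucker s t (pluckerGen.{u} s t) :=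
  (isPlucker_iff_forall_rel s t _).2 fun _ hp =>
    Ideal.Quotient.eq_zero_iff_mem.2 (Ideal.subset_span hp)

/-- Evaluation of a polynomial at a matrix. -/
def evalMat (W : κ → κ → R) : MatPoly.{u} κ →+* R :=
  MvPolynomial.eval₂Hom ((Int.castRingHom R).comp ULift.ringEquiv.toRingHom) fun p => W p.1 p.2

lemma evalMat_X (W : κ → κ → R) (a b : κ) : evalMat W (.X (a, b)) = W a b :=
  MvPolynomial.eval₂_X _ _ _

lemma span_pluckerRel_le_ker {W : κ → κ → R} (hW : IsPlucker s t W) :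
    Ideal.span (pluckerRel.{u} s t) ≤ RingHom.ker (evalMat.{u} W) := by
  refine Ideal.span_le.2 ((isPlucker_iff_forall_rel s t (evalMat W)).1 ?_)
  simpa only [evalMat_X] using hW

variable {s t}

/-- The ring homomorphism classifying Plücker coordinates. -/
def pluckerLift {W : κ → κ → R} (hW : IsPlucker s t W) : PluckerRing.{u} s t →+* R :=
  Ideal.Quotient.lift _ (evalMat W) (span_pluckerRel_le_ker s t hW)

lemma pluckerLift_gen {W : κ → κ → R} (hW : IsPlucker s t W) (a b : κ) :
    pluckerLift hW (pluckerGen.{u} s t a b) = W a b :=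
  evalMat_X W a b

lemma pluckerRing_hom_ext {f g : PluckerRing.{u} s t →+* R}
    (h : ∀ a b, f (pluckerGen s t a b) = g (pluckerGen s t a b)) : f = g := by
  refine Ideal.Quotient.ringHom_ext (MvPolynomial.ringHom_ext' ?_ fun p => h p.1 p.2)
  exact (RingHom.cancel_right (f := (ULift.ringEquiv (R := ℤ)).symm.toRingHom)
    (ULift.ringEquiv (R := ℤ)).symm.surjective).1 (RingHom.ext_int _ _)

variable (s t)

/-- The spectrum of the ring of Plücker coordinates. -/
abbrev pluckerSpec : Scheme.{u} := Spec (CommRingCat.of (PluckerRing.{u} s t))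

/-- The `k`-scheme of Plücker coordinates. -/
def pluckerScheme (k : Scheme.{u}) : Over k :=
  Over.mk (pullback.fst (terminal.from k) (terminal.from (pluckerSpec.{u} s t)))

/-- The projection to the absolute scheme of Plücker coordinates. -/
def toPluckerSpec (k : Scheme.{u}) : (pluckerScheme.{u} s t k).left ⟶ pluckerSpec.{u} s t :=
  pullback.snd _ _

variable {s t} {k T T' : Scheme.{u}}

/-- The Plücker coordinates of a point of `pluckerSpec`. -/
def specCoords (f : T ⟶ pluckerSpec.{u} s t) (a b : κ) : Γ(T, ⊤) :=
  f.appTop ((Scheme.ΓSpecIso (CommRingCat.of (PluckerRing.{u} s t))).inv (pluckerGen s t a b))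

lemma isPlucker_specCoords (f : T ⟶ pluckerSpec.{u} s t) : IsPlucker s t (specCoords f) :=
  (isPlucker_pluckerGen s t).map (((Scheme.ΓSpecIso _).inv ≫ f.appTop).hom)

lemma specCoords_injective :
    Function.Injective (specCoords : (T ⟶ pluckerSpec.{u} s t) → κ → κ → Γ(T, ⊤)) :=
  fun _ _ h => ext_to_Spec (CommRingCat.hom_ext (pluckerRing_hom_ext (congrFun₂ h)))

lemma exists_specCoords_eq {W : κ → κ → Γ(T, ⊤)} (hW : IsPlucker s t W) :
    ∃ f : T ⟶ pluckerSpec.{u} s t, specCoords f = W := by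
  refine ⟨T.toSpecΓ ≫ Spec.map (CommRingCat.ofHom (pluckerLift hW)), ?_⟩
  ext a b
  simp [specCoords, pluckerLift_gen]

/-- The Plücker coordinates of a point of `pluckerScheme`. -/
def pluckerCoords (f : T ⟶ (pluckerScheme s t k).left) (a b : κ) : Γ(T, ⊤) :=
  specCoords (f ≫ toPluckerSpec s t k) a b

lemma pluckerCoords_comp (g : T' ⟶ T) (f : T ⟶ (pluckerScheme s t k).left) :
    pluckerCoords (g ≫ f) = fun a b => g.appTop (pluckerCoords f a b) := by
  ext a b
  rw [pluckerCoords, Category.assoc]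
  rfl

lemma isPlucker_pluckerCoords (f : T ⟶ (pluckerScheme s t k).left) :
    IsPlucker s t (pluckerCoords f) :=
  isPlucker_specCoords _

lemma pluckerScheme_hom_ext {f g : T ⟶ (pluckerScheme s t k).left}
    (h : f ≫ (pluckerScheme s t k).hom = g ≫ (pluckerScheme s t k).hom)
    (hcoords : pluckerCoords f = pluckerCoords g) : f = g :=
  pullback.hom_ext h (specCoords_injective hcoords)

lemma exists_pluckerCoords_eq (x : T ⟶ k) {W : κ → κ → Γ(T, ⊤)} (hW : IsPlucker s t W) :
    ∃ f : T ⟶ (pluckerScheme s t k).left,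
      f ≫ (pluckerScheme s t k).hom = x ∧ pluckerCoords f = W := by
  obtain ⟨f, rfl⟩ := exists_specCoords_eq hW
  refine ⟨pullback.lift x f (terminal.hom_ext _ _), pullback.lift_fst _ _ _, ?_⟩
  ext a b
  exact congrArg (specCoords · a b) (pullback.lift_snd _ _ _)

instance : IsAffineHom (pluckerScheme s t k).hom :=
  MorphismProperty.of_isPullback (P := @IsAffineHom)
    (IsPullback.of_hasPullback (terminal.from k) (terminal.from (pluckerSpec.{u} s t))).flip
    inferInstance

/-- The open subscheme of `pluckerScheme` on which the planes are not contained in the hyperplane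
with index `c`. -/
def offHyperplane (c : κ) : (pluckerScheme s t k).left.Opens :=
  ⨆ a, (pluckerScheme s t k).left.basicOpen (pluckerCoords (𝟙 _) a c)

lemma preimage_offHyperplane (c : κ) (f : T ⟶ (pluckerScheme s t k).left) :
    f ⁻¹ᵁ offHyperplane c = ⨆ a, T.basicOpen (pluckerCoords f a c) := by
  have hcoords : pluckerCoords f = fun a b => f.appTop (pluckerCoords (𝟙 _) a b) := by
    rw [← pluckerCoords_comp, Category.comp_id]
  rw [hcoords, offHyperplane, Scheme.Hom.preimage_iSup]
  simp only [Scheme.preimage_basicOpen_top]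

lemma iSup_basicOpen_eq_top_of_span {ι : Type*} (v : ι → Γ(T, ⊤))
    (h : Ideal.span (Set.range v) = ⊤) : ⨆ a, T.basicOpen (v a) = ⊤ := by
  simpa only [iSup_range] using iSup_basicOpen_of_span_eq_top ⊤ _ h

lemma span_eq_top_of_iSup_basicOpen [IsAffine T] {ι : Type*} (v : ι → Γ(T, ⊤))
    (h : ⨆ a, T.basicOpen (v a) = ⊤) : Ideal.span (Set.range v) = ⊤ :=
  (isAffineOpen_top T).iSup_basicOpen_eq_self_iff.1 (by rw [iSup_subtype, iSup_range, h])

end PluckerScheme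

/-! ### A model of the stratum -/

section StratumScheme

variable (k : Scheme.{u}) (n i : ℕ)

/-- A model of the stratum: the planes in `E_i^⊥` on which the form is nondegenerate and which are
at no point contained in the hyperplane `E_{i+1}^⊥`. -/
def stratumScheme : Over k :=
  openSub (pluckerScheme (perpSrc n i) (perpTgt n i) k) (offHyperplane (perpTgt n i none))

/-- The inclusion of the stratum in its closure. -/
def stratumIncl :
    (stratumScheme k n i).left ⟶ (pluckerScheme (perpSrc n i) (perpTgt n i) k).left :=
  Scheme.Opens.ι _

instance : IsOpenImmersion (stratumIncl k n i) :=
  inferInstanceAs (IsOpenImmersion (Scheme.Opens.ι _))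

lemma stratumIncl_over : stratumIncl k n i ≫ (pluckerScheme (perpSrc n i) (perpTgt n i) k).hom =
    (stratumScheme k n i).hom := rfl

lemma range_stratumIncl : Set.range (stratumIncl k n i) = (offHyperplane (perpTgt n i none) :
    (pluckerScheme (perpSrc n i) (perpTgt n i) k).left.Opens) :=
  Scheme.Opens.range_ι _

variable {k n i} {T : Scheme.{u}}

/-- The Plücker coordinates of a point of the stratum. -/
def stratumCoords (f : T ⟶ (stratumScheme k n i).left) : PerpIdx n i → PerpIdx n i → Γ(T, ⊤) :=
  pluckerCoords (f ≫ stratumIncl k n i)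

lemma stratumCoords_comp {T' : Scheme.{u}} (g : T' ⟶ T) (f : T ⟶ (stratumScheme k n i).left) :
    stratumCoords (g ≫ f) = fun a b => g.appTop (stratumCoords f a b) := by
  rw [stratumCoords, Category.assoc, pluckerCoords_comp]
  rfl

lemma isPlucker_stratumCoords (f : T ⟶ (stratumScheme k n i).left) :
    IsPlucker (perpSrc n i) (perpTgt n i) (stratumCoords f) :=
  isPlucker_pluckerCoords _

lemma iSup_basicOpen_stratumCoords (f : T ⟶ (stratumScheme k n i).left) :
    ⨆ a, T.basicOpen (stratumCoords f a (perpTgt n i none)) = ⊤ := by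
  rw [stratumCoords, ← preimage_offHyperplane, eq_top_iff]
  intro x _
  have hx : (f ≫ stratumIncl k n i) x ∈ Set.range (stratumIncl k n i) :=
    ⟨f x, (Scheme.Hom.comp_apply _ _ _).symm⟩
  rwa [range_stratumIncl] at hx

lemma span_stratumCoords [IsAffine T] (f : T ⟶ (stratumScheme k n i).left) :
    Ideal.span (Set.range fun a => stratumCoords f a (perpTgt n i none)) = ⊤ :=
  span_eq_top_of_iSup_basicOpen _ (iSup_basicOpen_stratumCoords f)

lemma stratumScheme_hom_ext {f g : T ⟶ (stratumScheme k n i).left}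
    (h : f ≫ (stratumScheme k n i).hom = g ≫ (stratumScheme k n i).hom)
    (hcoords : stratumCoords f = stratumCoords g) : f = g := by
  rw [← cancel_mono (stratumIncl k n i)]
  refine pluckerScheme_hom_ext ?_ hcoords
  rw [Category.assoc, Category.assoc, stratumIncl_over, h]

lemma exists_stratumCoords_eq (x : T ⟶ k) {W : PerpIdx n i → PerpIdx n i → Γ(T, ⊤)}
    (hW : IsPlucker (perpSrc n i) (perpTgt n i) W)
    (hcol : Ideal.span (Set.range fun a => W a (perpTgt n i none)) = ⊤) :
    ∃ f : T ⟶ (stratumScheme k n i).left, f ≫ (stratumScheme k n i).hom = x ∧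
      stratumCoords f = W := by
  obtain ⟨f, rfl, rfl⟩ := exists_pluckerCoords_eq x hW
  have htop : f ⁻¹ᵁ offHyperplane (perpTgt n i none) = ⊤ := by
    rw [preimage_offHyperplane, iSup_basicOpen_eq_top_of_span _ hcol]
  have hrange : Set.range f ⊆ Set.range (stratumIncl k n i) := by
    rw [range_stratumIncl]
    rintro _ ⟨y, rfl⟩
    exact (htop.symm ▸ trivial : y ∈ f ⁻¹ᵁ offHyperplane (perpTgt n i none))
  refine ⟨IsOpenImmersion.lift (stratumIncl k n i) f hrange, ?_, ?_⟩
  · rw [← stratumIncl_over, ← Category.assoc, IsOpenImmersion.lift_fac]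
  · rw [stratumCoords, IsOpenImmersion.lift_fac]

section Affine

variable {R : CommRingCat.{u}}

/-- The Plücker coordinates of an affine point of the stratum. -/
def affineCoords (y : Spec R ⟶ (stratumScheme k n i).left) (a b : PerpIdx n i) : R :=
  (Scheme.ΓSpecIso R).hom (stratumCoords y a b)

lemma affineCoords_comp {R' : CommRingCat.{u}} (g : R ⟶ R')
    (y : Spec R ⟶ (stratumScheme k n i).left) :
    affineCoords (Spec.map g ≫ y) = fun a b => g.hom (affineCoords y a b) := by
  ext a b
  simp only [affineCoords, stratumCoords_comp]
  exact ConcreteCategory.congr_hom (Scheme.ΓSpecIso_naturality g) (stratumCoords y a b)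

lemma isPlucker_affineCoords (y : Spec R ⟶ (stratumScheme k n i).left) :
    IsPlucker (perpSrc n i) (perpTgt n i) (affineCoords y) :=
  (isPlucker_stratumCoords y).map (Scheme.ΓSpecIso R).hom.hom

lemma span_range_map_eq_top {A B ι : Type*} [CommRing A] [CommRing B] (g : A →+* B) {v : ι → A}
    (h : Ideal.span (Set.range v) = ⊤) : Ideal.span (Set.range fun a => g (v a)) = ⊤ := by
  rw [← Ideal.map_top g, ← h, Ideal.map_span, ← Set.range_comp]
  rfl

lemma span_affineCoords (y : Spec R ⟶ (stratumScheme k n i).left) :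
    Ideal.span (Set.range fun a => affineCoords y a (perpTgt n i none)) = ⊤ :=
  span_range_map_eq_top (Scheme.ΓSpecIso R).hom.hom (span_stratumCoords y)

lemma stratumScheme_affine_hom_ext {y z : Spec R ⟶ (stratumScheme k n i).left}
    (h : y ≫ (stratumScheme k n i).hom = z ≫ (stratumScheme k n i).hom)
    (hcoords : affineCoords y = affineCoords z) : y = z :=
  stratumScheme_hom_ext h <| funext₂ fun a b =>
    (ConcreteCategory.bijective_of_isIso (Scheme.ΓSpecIso R).hom).1 (congrFun₂ hcoords a b)

lemma exists_affineCoords_eq (x : Spec R ⟶ k) {W : PerpIdx n i → PerpIdx n i → R}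
    (hW : IsPlucker (perpSrc n i) (perpTgt n i) W)
    (hcol : Ideal.span (Set.range fun a => W a (perpTgt n i none)) = ⊤) :
    ∃ y : Spec R ⟶ (stratumScheme k n i).left, y ≫ (stratumScheme k n i).hom = x ∧
      affineCoords y = W := by
  obtain ⟨y, hy, hyW⟩ := exists_stratumCoords_eq x (hW.map (Scheme.ΓSpecIso R).inv.hom)
    (span_range_map_eq_top (Scheme.ΓSpecIso R).inv.hom hcol)
  refine ⟨y, hy, funext₂ fun a b => ?_⟩
  rw [affineCoords, hyW]
  exact ConcreteCategory.congr_hom (Scheme.ΓSpecIso R).inv_hom_id (W a b)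

/-- The model of the stratum represents the functor of points of the stratum. -/
def isStratum_stratumScheme (hi : i ≤ n) : IsStratum n i (stratumScheme k n i) where
  taut y := rowSpan (extendByZero (perpEmb hi) (affineCoords y))
  taut_mem y := (mem_stratumPoints_iff_exists_perp hi).2
    ⟨_, isPlucker_affineCoords y, span_affineCoords y, rfl⟩
  taut_comp g y := by
    rw [pullbackSub_rowSpan, extendByZero_map, affineCoords_comp]
  existsUnique {R} x U hU := by
    obtain ⟨W, hW, hcol, rfl⟩ := (mem_stratumPoints_iff_exists_perp hi).1 hU
    obtain ⟨y, hy, rfl⟩ := exists_affineCoords_eq x hW hcol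
    refine ⟨y, ⟨hy, rfl⟩, ?_⟩
    rintro z ⟨hz, hzy⟩
    have hext (w : Spec R ⟶ (stratumScheme k n i).left) :=
      (isPlucker_affineCoords w).extendByZero (perpEmb_injective hi)
        (sum_extendByZero_perpEmb hi (affineCoords w))
    exact stratumScheme_affine_hom_ext (hz.trans hy.symm)
      (extendByZero_injective (perpEmb_injective hi) ((hext z).eq_of_rowSpan_eq (hext y) hzy))

end Affine

end StratumScheme

/-! ### The action of the additive group -/

section Action

variable {k : Scheme.{u}} {ι : Type u} {T T' : Over k}

lemma coordsOf_pointOf (v : ι → Γ(T.left, ⊤)) : coordsOf (pointOf T v) = v :=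
  funext fun _ => AffineSpace.homOfVector_appTop_coord _ _ _

lemma coordsOf_injective : Function.Injective (coordsOf : (T ⟶ affineSp k ι) → ι → Γ(T.left, ⊤)) :=
  fun x y h => Over.OverMorphism.ext <|
    AffineSpace.hom_ext ((Over.w x).trans (Over.w y).symm) (congrFun h)

lemma coordsOf_comp (f : T' ⟶ T) (x : T ⟶ affineSp k ι) :
    coordsOf (f ≫ x) = fun j => f.left.appTop (coordsOf x j) := rfl

variable {n i : ℕ}

lemma coordsOf_comp_cellAction (m : T ⟶ affineLine k ⊗ affineSp k (CellIdx.{u} n i)) :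
    coordsOf (m ≫ cellAction k n i) =
      cellFormula n i (coordsOf (m ≫ fst _ _) ⟨⟩) (coordsOf (m ≫ snd _ _)) := by
  rw [coordsOf_comp, cellAction, coordsOf_pointOf, coordsOf_comp, coordsOf_comp]
  exact (cellFormula_map m.left.appTop.hom _ _).symm

lemma coordsOf_actBy (t : Γ(T.left, ⊤)) (x : T ⟶ affineSp k (CellIdx.{u} n i)) :
    coordsOf (actBy (cellAction k n i) t x) = cellFormula n i t (coordsOf x) := by
  rw [actBy, coordsOf_comp_cellAction, lift_fst, lift_snd, coordsOf_pointOf]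

lemma isGaAction_cellAction : IsGaAction (cellAction k n i) where
  zero_act x := coordsOf_injective (by rw [coordsOf_actBy, cellFormula_zero])
  add_act s t x := coordsOf_injective (by simp only [coordsOf_actBy, cellFormula_add])

lemma isFreeGa_cellAction : IsFreeGa (cellAction k n i) := fun t x h =>
  cellFormula_left_injective (coordsOf x) <| by
    simp only [← coordsOf_actBy, h, cellFormula_zero]

end Action

/-! ### The quotient -/

section Quotient

variable (k : Scheme.{u}) (n i : ℕ)

lemma exists_cellProj : ∃ π : affineSp k (CellIdx.{u} n i) ⟶ stratumScheme k n i,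
    stratumCoords π.left = cellW (coordsOf (𝟙 (affineSp k (CellIdx.{u} n i)))) := by
  obtain ⟨f, hf, hfW⟩ := exists_stratumCoords_eq (affineSp k (CellIdx.{u} n i)).hom
    (isPlucker_cellW (coordsOf (𝟙 (affineSp k (CellIdx.{u} n i)))))
    (by simp only [cellW_perpTgt_none]; exact span_range_cellU _)
  exact ⟨Over.homMk f hf, hfW⟩

/-- The map sending `(α, a, β, b, r)` to the plane spanned by `u` and `v`. -/
def cellProj : affineSp k (CellIdx.{u} n i) ⟶ stratumScheme k n i :=
  (exists_cellProj k n i).choose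

variable {k n i} {T : Over k}

lemma stratumCoords_comp_cellProj (x : T ⟶ affineSp k (CellIdx.{u} n i)) :
    stratumCoords (x ≫ cellProj k n i).left = cellW (coordsOf x) := by
  rw [Over.comp_left, stratumCoords_comp, cellProj, (exists_cellProj k n i).choose_spec,
    ← Category.comp_id x, coordsOf_comp, Category.comp_id]
  exact (cellW_map x.left.appTop.hom _).symm

lemma comp_cellProj_eq_iff {x y : T ⟶ affineSp k (CellIdx.{u} n i)} :
    x ≫ cellProj k n i = y ≫ cellProj k n i ↔ cellW (coordsOf x) = cellW (coordsOf y) := by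
  rw [← stratumCoords_comp_cellProj, ← stratumCoords_comp_cellProj]
  refine ⟨fun h => by rw [h], fun h => ?_⟩
  ext1
  refine stratumScheme_hom_ext ?_ h
  rw [Over.w, Over.w]

lemma cellAction_comp_cellProj : cellAction k n i ≫ cellProj k n i =
    snd (affineLine k) (affineSp k (CellIdx.{u} n i)) ≫ cellProj k n i := by
  rw [comp_cellProj_eq_iff, cellAction, coordsOf_pointOf, cellW_cellFormula]

lemma cellAction_snd_jointly_mono {m m' : T ⟶ affineLine k ⊗ affineSp k (CellIdx.{u} n i)}
    (hact : m ≫ cellAction k n i = m' ≫ cellAction k n i) (hsnd : m ≫ snd _ _ = m' ≫ snd _ _) :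
    m = m' := by
  refine CartesianMonoidalCategory.hom_ext _ _ (coordsOf_injective (funext fun _ => ?_)) hsnd
  have h := congrArg coordsOf hact
  rw [coordsOf_comp_cellAction, coordsOf_comp_cellAction, ← hsnd] at h
  exact cellFormula_left_injective _ h

lemma isPullback_cellProj : IsPullback (cellAction k n i)
    (snd (affineLine k) (affineSp k (CellIdx.{u} n i))) (cellProj k n i) (cellProj k n i) := by
  let tr (c : PullbackCone (cellProj k n i) (cellProj k n i)) : Γ(c.pt.left, ⊤) :=
    pairingForm (perpSrc n i) (perpTgt n i) (cellV (coordsOf c.fst)) (cellV (coordsOf c.snd))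
  have htr (c : PullbackCone (cellProj k n i) (cellProj k n i)) :
      actBy (cellAction k n i) (tr c) c.snd = c.fst := coordsOf_injective <| by
    rw [coordsOf_actBy]
    exact (eq_cellFormula_of_cellW_eq (comp_cellProj_eq_iff.1 c.condition.symm)).symm
  exact ⟨⟨cellAction_comp_cellProj⟩, ⟨PullbackCone.IsLimit.mk _
    (fun c => lift (pointOf _ fun _ => tr c) c.snd) htr (fun c => lift_snd _ _)
    fun c m hfst hsnd => cellAction_snd_jointly_mono (hfst.trans (htr c).symm)
      (hsnd.trans (lift_snd _ _).symm)⟩⟩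

lemma exists_comp_cellProj_eq {T : Scheme.{u}} [IsAffine T]
    (f : T ⟶ (stratumScheme k n i).left) :
    ∃ s : T ⟶ (affineSp k (CellIdx.{u} n i)).left, s ≫ (cellProj k n i).left = f := by
  obtain ⟨x, hx⟩ := exists_cellW_eq (isPlucker_stratumCoords f) (span_stratumCoords f)
  let y : Over.mk (f ≫ (stratumScheme k n i).hom) ⟶ affineSp k (CellIdx.{u} n i) := pointOf _ x
  refine ⟨y.left, stratumScheme_hom_ext ?_ ?_⟩
  · rw [← Over.comp_left, Over.w]
    rfl
  · rw [← Over.comp_left, stratumCoords_comp_cellProj, coordsOf_pointOf, hx]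

end Quotient

section LocalSections

/-- The morphism `π` has sections Zariski locally on the target. -/
def HasLocalSections {P X : Scheme.{u}} (π : P ⟶ X) : Prop :=
  ∀ x : X, ∃ U : X.Opens, x ∈ U ∧ ∃ s : (U : Scheme.{u}) ⟶ P, s ≫ π = U.ι

lemma HasLocalSections.epi {P X : Scheme.{u}} {π : P ⟶ X} (hπ : HasLocalSections π) : Epi π where
  left_cancellation g h hgh := Scheme.hom_ext_of_forall _ _ fun x => by
    obtain ⟨U, hU, s, hs⟩ := hπ x
    exact ⟨U, hU, by rw [← hs, Category.assoc, hgh, Category.assoc]⟩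

lemma comp_eq_comp_of_isKernelPair {k : Scheme.{u}} {E P X Z : Over k} {p q : E ⟶ P} {π : P ⟶ X}
    (h : IsPullback p q π π) {φ : P ⟶ Z} (hφ : p ≫ φ = q ≫ φ) {T : Scheme.{u}} {a b : T ⟶ P.left}
    (hab : a ≫ π.left = b ≫ π.left) : a ≫ φ.left = b ≫ φ.left := by
  have hb : b ≫ P.hom = a ≫ P.hom := by rw [← Over.w π, reassoc_of% hab]
  let a' : Over.mk (a ≫ P.hom) ⟶ P := Over.homMk a
  let b' : Over.mk (a ≫ P.hom) ⟶ P := Over.homMk b hb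
  have hab' : a' ≫ π = b' ≫ π := Over.OverMorphism.ext hab
  have hφ' : a' ≫ φ = b' ≫ φ := by
    rw [← h.lift_fst a' b' hab', Category.assoc, hφ, ← Category.assoc, h.lift_snd]
  exact congrArg Over.Hom.left hφ'

lemma HasLocalSections.exists_desc {P X Z : Scheme.{u}} {π : P ⟶ X} (hπ : HasLocalSections π)
    {φ : P ⟶ Z} (hφ : ∀ {T : Scheme.{u}} {a b : T ⟶ P}, a ≫ π = b ≫ π → a ≫ φ = b ≫ φ) :
    ∃ g : X ⟶ Z, π ≫ g = φ := by
  choose U hU s hs using hπ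
  let 𝒰 : X.OpenCover := X.openCoverOfIsOpenCover U (.mk (eq_top_iff.2 fun x _ =>
    TopologicalSpace.Opens.mem_iSup.2 ⟨x, hU x⟩))
  have compatible (x y : X) : pullback.fst (U x).ι (U y).ι ≫ s x ≫ φ =
      pullback.snd (U x).ι (U y).ι ≫ s y ≫ φ := by
    rw [← Category.assoc, ← Category.assoc]
    apply hφ
    rw [Category.assoc, Category.assoc, hs, hs, pullback.condition]
  let g : X ⟶ Z := 𝒰.glueMorphisms (fun x => s x ≫ φ) compatible
  have hg (x : X) : (U x).ι ≫ g = s x ≫ φ := 𝒰.ι_glueMorphisms _ _ x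
  refine ⟨g, Scheme.hom_ext_of_forall _ _ fun y => ⟨π ⁻¹ᵁ U (π y), hU _, ?_⟩⟩
  rw [← morphismRestrict_ι_assoc, hg, ← Category.assoc]
  apply hφ
  rw [Category.assoc, hs, morphismRestrict_ι]

lemma nonempty_isColimit_of_hasLocalSections {k : Scheme.{u}} {E P X : Over k} {p q : E ⟶ P}
    {π : P ⟶ X} (h : IsPullback p q π π) (hπ : HasLocalSections π.left) :
    Nonempty (IsColimit (Cofork.ofπ π h.w)) := by
  have : Epi π.left := hπ.epi
  have : Epi π := (Over.forget k).epi_of_epi_map this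
  have hdesc (c : Cofork p q) : ∃ g : X ⟶ c.pt, π ≫ g = c.π := by
    obtain ⟨g, hg⟩ := hπ.exists_desc (comp_eq_comp_of_isKernelPair h c.condition)
    refine ⟨Over.homMk g ?_, Over.OverMorphism.ext hg⟩
    rw [← cancel_epi π.left, ← Category.assoc, hg, Over.w, Over.w]
  choose desc fac using hdesc
  exact ⟨Cofork.IsColimit.mk _ desc fac fun c m hm =>
    (cancel_epi π).1 (hm.trans (fac c).symm)⟩

lemma isGaQuotient_of_iso {k : Scheme.{u}} {n i : ℕ} {X : Over k} (e : stratumScheme k n i ≅ X) :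
    IsGaQuotient (cellAction k n i) (cellProj k n i ≫ e.hom) := by
  have hpull : IsPullback (cellAction k n i) (snd (affineLine k) (affineSp k (CellIdx.{u} n i)))
      (cellProj k n i ≫ e.hom) (cellProj k n i ≫ e.hom) :=
    IsKernelPair.comp_of_mono isPullback_cellProj
  have hsections : HasLocalSections (cellProj k n i ≫ e.hom).left := by
    intro x
    obtain ⟨U, hU, hxU⟩ := exists_isAffineOpen_mem_and_subset (U := ⊤) (x := x) trivial
    have : IsAffine U := hU
    obtain ⟨s, hs⟩ := exists_comp_cellProj_eq (U.ι ≫ e.inv.left)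
    refine ⟨U, hxU.1, s, ?_⟩
    rw [Over.comp_left, ← Category.assoc, hs, Category.assoc, ← Over.comp_left, e.inv_hom_id,
      Over.id_left, Category.comp_id]
  exact ⟨hpull, hsections, nonempty_isColimit_of_hasLocalSections hpull hsections⟩

end LocalSections

/-! ### Open subschemes and admissible categories -/

section OpenSubschemes

variable {k : Scheme.{u}}

lemma isPullback_of_left {X Y Z W : Over k} {f : X ⟶ Y} {g : X ⟶ Z} {h : Y ⟶ W}
    {l : Z ⟶ W} (H : IsPullback f.left g.left h.left l.left) : IsPullback f g h l := by
  refine IsPullback.of_map (Over.forget k) ?_ H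
  ext1
  exact H.w

/-- The inclusion of an open subscheme. -/
def openIncl (X : Over k) (U : X.left.Opens) : openSub X U ⟶ X :=
  Over.homMk U.ι

instance (X : Over k) (U : X.left.Opens) :
    IsOpenImmersion (openIncl X U).left :=
  inferInstanceAs (IsOpenImmersion U.ι)

lemma range_openIncl (X : Over k) (U : X.left.Opens) :
    Set.range (openIncl X U).left = U :=
  U.range_ι

/-- The restriction of a morphism to the preimage of an open subscheme. -/
def openRestrict {E Y : Over k} (p : E ⟶ Y) (U : Y.left.Opens) :
    openSub E (p.left ⁻¹ᵁ U) ⟶ openSub Y U :=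
  Over.homMk (p.left ∣_ U) (by
    change (p.left ∣_ U) ≫ U.ι ≫ Y.hom = (p.left ⁻¹ᵁ U).ι ≫ E.hom
    rw [morphismRestrict_ι_assoc, Over.w])

lemma isPullback_openRestrict {E Y : Over k} (p : E ⟶ Y) (U : Y.left.Opens) :
    IsPullback (openIncl E (p.left ⁻¹ᵁ U)) (openRestrict p U) p (openIncl Y U) :=
  isPullback_of_left (isPullback_morphismRestrict p.left U).flip

lemma exists_comp_openIncl {T Y : Over k} (f : T ⟶ Y) {D : Y.left.Opens}
    (h : Set.range f.left ⊆ D) : ∃ g : T ⟶ openSub Y D, g ≫ openIncl Y D = f := by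
  have hrange : Set.range f.left ⊆ Set.range D.ι := by rwa [D.range_ι]
  have hfac := IsOpenImmersion.lift_fac D.ι f.left hrange
  refine ⟨Over.homMk (IsOpenImmersion.lift D.ι f.left hrange) ?_, Over.OverMorphism.ext hfac⟩
  change _ ≫ D.ι ≫ Y.hom = _
  rw [reassoc_of% hfac, Over.w]

end OpenSubschemes

section Admissible

variable {k : Scheme.{u}} {V : ObjectProperty (Over k)} (hV : IsAdmissible V)

include hV

lemma IsAdmissible.quasiCompact {E Y : Over k} (hE : V E) (hY : V Y) (p : E ⟶ Y) :
    QuasiCompact p.left := by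
  have := hV.compactSpace hE
  have := hV.quasiSeparatedSpace hY
  infer_instance

lemma IsAdmissible.isCompact_of_mem {Y : Over k} {U : Y.left.Opens} (hU : V (openSub Y U)) :
    IsCompact (U : Set Y.left) :=
  isCompact_iff_compactSpace.2 (hV.compactSpace hU)

lemma IsAdmissible.preimage_mem {E Y : Over k} (hE : V E) (hY : V Y) (p : E ⟶ Y)
    {U : Y.left.Opens} (hU : IsCompact (U : Set Y.left)) : V (openSub E (p.left ⁻¹ᵁ U)) := by
  have := hV.quasiCompact hE hY p
  exact hV.open_mem hE _ (p.left.isCompact_preimage hU)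

end Admissible

section PreimagePairs

variable {k : Scheme.{u}} {V : ObjectProperty (Over k)} (hV : IsAdmissible V)

/-- The preimage of a pair under a morphism. -/
abbrev preimagePair (Q : VPair V) {E : Over k} (p : E ⟶ Q.X) (hE : V E) : VPair V where
  X := E
  Z := Q.Z.preimage p.left.continuous
  mem := hE
  compl_mem := hV.preimage_mem hE Q.mem p (hV.isCompact_of_mem Q.compl_mem)

/-- The morphism from the preimage of a pair. -/
abbrev preimageMap (Q : VPair V) {E : Over k} (p : E ⟶ Q.X) (hE : V E) :
    preimagePair hV Q p hE ⟶ Q :=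
  VPair.Hom.mk p fun _ h => h

/-- The map that the preimage of a pair induces on complements. -/
abbrev preimageComplMap (Q : VPair V) {E : Over k} (p : E ⟶ Q.X) (hE : V E) :
    complPair hV (preimagePair hV Q p hE) ⟶ complPair hV Q :=
  fullMap hV (preimagePair hV Q p hE).compl_mem Q.compl_mem (openRestrict p Q.Z.compl)

lemma preimageComplMap_comp_resMap (Q : VPair V) {E : Over k} (p : E ⟶ Q.X) (hE : V E) :
    preimageComplMap hV Q p hE ≫ resMap hV Q =
      resMap hV (preimagePair hV Q p hE) ≫ fullMap hV hE Q.mem p :=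
  VPair.Hom.ext (isPullback_openRestrict p Q.Z.compl).w.symm

end PreimagePairs

/-! ### Locally trivial bundles of affine lines -/

section LocalTriviality

variable {k : Scheme.{u}}

/-- Local triviality of `p` along `f`: the base change is a trivial line bundle. -/
def TrivOver {E Y T : Over k} (p : E ⟶ Y) (f : T ⟶ Y) : Prop :=
  ∃ τ : T ⊗ affineLine k ⟶ E, IsPullback τ (fst T (affineLine k)) p f

lemma isPullback_whiskerRight_fst {T' T : Over k} (h : T' ⟶ T) (L : Over k) :
    IsPullback (h ▷ L) (fst T' L) (fst T L) h := by
  refine ⟨⟨by simp⟩, ⟨PullbackCone.IsLimit.mk _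
    (fun c => lift c.snd (c.fst ≫ snd T L)) (fun c => ?_) (fun c => ?_) fun c m h₁ h₂ => ?_⟩⟩
  · ext1
    · simpa using c.condition.symm
    · simp
  · simp
  · ext1
    · simpa using h₂
    · simp [← h₁]

lemma TrivOver.precomp {E Y T T' : Over k} {p : E ⟶ Y} {f : T ⟶ Y}
    (h : TrivOver p f) (g : T' ⟶ T) : TrivOver p (g ≫ f) := by
  obtain ⟨τ, h⟩ := h
  exact ⟨_, (isPullback_whiskerRight_fst g _).paste_horiz h⟩

end LocalTriviality

namespace CohomologyTheory

variable {k : Scheme.{u}} {V : ObjectProperty (Over k)} {hV : IsAdmissible V}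
  (A : CohomologyTheory.{w} hV)

lemma pull_comp {X Y Z : Over k} (hX : V X) (hY : V Y) (hZ : V Z) (f : X ⟶ Y) (g : Y ⟶ Z) :
    A.pull hX hZ (f ≫ g) = A.pull hY hZ g ≫ A.pull hX hY f := by
  unfold pull
  rw [← A.A.map_comp, ← op_comp]
  rfl

lemma pull_id {X : Over k} (hX hX' : V X) : A.pull hX hX' (𝟙 X) = 𝟙 _ :=
  A.A.map_id _

instance isIso_pull {X Y : Over k} (hX : V X) (hY : V Y) (f : X ⟶ Y) [IsIso f] :
    IsIso (A.pull hX hY f) := by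
  refine ⟨A.pull hY hX (inv f), ?_, ?_⟩
  · rw [← pull_comp, IsIso.inv_hom_id, pull_id]
  · rw [← pull_comp, IsIso.hom_inv_id, pull_id]

section FiveLemma

variable {P Q : VPair V} (F : P ⟶ Q) (g : complPair hV P ⟶ complPair hV Q)
  (hg : g ≫ resMap hV Q = resMap hV P ≫ fullMap hV P.mem Q.mem F.f)

include hg in
lemma map_res_comp : A.A.map (resMap hV Q).op ≫ A.A.map g.op =
    A.pull P.mem Q.mem F.f ≫ A.A.map (resMap hV P).op := by
  unfold pull
  rw [← A.A.map_comp, ← A.A.map_comp, ← op_comp, ← op_comp, hg]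

lemma map_ext_comp : A.A.map (extMap hV Q).op ≫ A.pull P.mem Q.mem F.f =
    A.A.map F.op ≫ A.A.map (extMap hV P).op := by
  unfold pull
  rw [← A.A.map_comp, ← A.A.map_comp, ← op_comp, ← op_comp]
  congr 2

include hg in
lemma isIso_map_of_isIso_pull (h₁ : IsIso (A.pull P.mem Q.mem F.f)) (h₂ : IsIso (A.A.map g.op)) :
    IsIso (A.A.map F.op) := by
  rw [ConcreteCategory.isIso_iff_bijective] at h₁ h₂ ⊢
  have c₁ := congrArg AddCommGrpCat.Hom.hom (A.map_res_comp F g hg)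
  have c₂ := congrArg AddCommGrpCat.Hom.hom (A.bd_natural F g hg)
  have c₃ := congrArg AddCommGrpCat.Hom.hom (A.map_ext_comp F)
  exact AddMonoidHom.bijective_of_surjective_of_bijective_of_bijective_of_injective
    (A.A.map (resMap hV Q).op).hom (A.bd Q).hom (A.A.map (extMap hV Q).op).hom
    (A.A.map (resMap hV Q).op).hom
    (A.A.map (resMap hV P).op).hom (A.bd P).hom (A.A.map (extMap hV P).op).hom
    (A.A.map (resMap hV P).op).hom
    (A.pull P.mem Q.mem F.f).hom (A.A.map g.op).hom (A.A.map F.op).hom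
    (A.pull P.mem Q.mem F.f).hom (A.A.map g.op).hom
    c₁.symm c₂.symm c₃.symm c₁.symm (A.exact_open Q) (A.exact_supp Q) (A.exact_total Q)
    (A.exact_open P) (A.exact_supp P) (A.exact_total P) h₁.2 h₂ h₁ h₂.1

include hg in
lemma isIso_pull_of_isIso_map (h₁ : IsIso (A.A.map F.op)) (h₂ : IsIso (A.A.map g.op)) :
    IsIso (A.pull P.mem Q.mem F.f) := by
  rw [ConcreteCategory.isIso_iff_bijective] at h₁ h₂ ⊢
  have c₁ := congrArg AddCommGrpCat.Hom.hom (A.map_res_comp F g hg)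
  have c₂ := congrArg AddCommGrpCat.Hom.hom (A.bd_natural F g hg)
  have c₃ := congrArg AddCommGrpCat.Hom.hom (A.map_ext_comp F)
  exact AddMonoidHom.bijective_of_surjective_of_bijective_of_bijective_of_injective
    (A.bd Q).hom (A.A.map (extMap hV Q).op).hom (A.A.map (resMap hV Q).op).hom (A.bd Q).hom
    (A.bd P).hom (A.A.map (extMap hV P).op).hom (A.A.map (resMap hV P).op).hom (A.bd P).hom
    (A.A.map g.op).hom (A.A.map F.op).hom (A.pull P.mem Q.mem F.f).hom (A.A.map g.op).hom
    (A.A.map F.op).hom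
    c₂.symm c₃.symm c₁.symm c₂.symm (A.exact_supp Q) (A.exact_total Q) (A.exact_open Q)
    (A.exact_supp P) (A.exact_total P) (A.exact_open P) h₂.2 h₁ h₂ h₁.1

end FiveLemma

/-- Pullback along `p` is an isomorphism. -/
def PullIso {E Y : Over k} (p : E ⟶ Y) : Prop :=
  ∀ (hE : V E) (hY : V Y), IsIso (A.pull hE hY p)

/-- Every base change of `p` along `f` induces an isomorphism. -/
def PullIsoOver {E Y T : Over k} (p : E ⟶ Y) (f : T ⟶ Y) : Prop :=
  ∀ {E' : Over k} (g : E' ⟶ E) (p' : E' ⟶ T), IsPullback g p' p f → A.PullIso p'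

variable {A}

lemma isIso_map_of_isOpenImmersion {P Q : VPair V} (F : P ⟶ Q) [IsOpenImmersion F.f.left]
    (hF : ∀ x : P.X.left, F.f.left x ∈ Q.Z ↔ x ∈ P.Z)
    (hZ : (Q.Z : Set Q.X.left) ⊆ Set.range F.f.left) : IsIso (A.A.map F.op) := by
  refine A.excision _ inferInstance hF ?_
  have h : Set.range (Scheme.IdealSheafData.vanishingIdeal Q.Z).subschemeι ⊆
      Set.range F.f.left := by
    rwa [Scheme.IdealSheafData.range_subschemeι,
      Scheme.IdealSheafData.coe_support_vanishingIdeal]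
  refine ⟨pullback.lift (𝟙 _) (IsOpenImmersion.lift F.f.left _ h) ?_, ?_, ?_⟩
  · rw [Category.id_comp]
    exact (IsOpenImmersion.lift_fac F.f.left _ h).symm
  · rw [← cancel_mono (pullback.fst _ _), Category.assoc, pullback.lift_fst, Category.comp_id,
      Category.id_comp]
  · exact pullback.lift_fst _ _ _

lemma isIso_map_preimageMap_of_neighbourhood (Q : VPair V) {E : Over k} (p : E ⟶ Q.X) (hE : V E)
    {U : Q.X.left.Opens} (hU : V (openSub Q.X U)) (hEU : V (openSub E (p.left ⁻¹ᵁ U)))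
    (hZU : (Q.Z : Set Q.X.left) ⊆ U)
    (h : IsIso (A.A.map (preimageMap hV (preimagePair hV Q (openIncl Q.X U) hU)
      (openRestrict p U) hEU).op)) :
    IsIso (A.A.map (preimageMap hV Q p hE).op) := by
  let J := preimageMap hV Q (openIncl Q.X U) hU
  let P := preimagePair hV Q p hE
  let P' := preimagePair hV (preimagePair hV Q (openIncl Q.X U) hU) (openRestrict p U) hEU
  let F' := preimageMap hV (preimagePair hV Q (openIncl Q.X U) hU) (openRestrict p U) hEU
  have hsq := (isPullback_openRestrict p U).w
  have hmem (x : (openSub E (p.left ⁻¹ᵁ U)).left) :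
      (openIncl E (p.left ⁻¹ᵁ U)).left x ∈ P.Z ↔ x ∈ P'.Z := by
    have hx := congrArg (fun f => f.left x) hsq
    simp only [Over.comp_left, Scheme.Hom.comp_apply] at hx
    change p.left _ ∈ Q.Z ↔ (openIncl Q.X U).left _ ∈ Q.Z
    rw [hx]
  let J' : P' ⟶ P := VPair.Hom.mk (openIncl E (p.left ⁻¹ᵁ U)) fun x hx => (hmem x).1 hx
  have hJ : IsIso (A.A.map J.op) := by
    have : IsOpenImmersion J.f.left := inferInstanceAs (IsOpenImmersion (openIncl Q.X U).left)
    exact isIso_map_of_isOpenImmersion J (fun _ => Iff.rfl) (hZU.trans (range_openIncl Q.X U).ge)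
  have hJ' : IsIso (A.A.map J'.op) := by
    have : IsOpenImmersion J'.f.left :=
      inferInstanceAs (IsOpenImmersion (openIncl E (p.left ⁻¹ᵁ U)).left)
    exact isIso_map_of_isOpenImmersion J' hmem
      fun x hx => (range_openIncl E (p.left ⁻¹ᵁ U)).ge (hZU hx)
  have hcomm : A.A.map (preimageMap hV Q p hE).op ≫ A.A.map J'.op =
      A.A.map J.op ≫ A.A.map F'.op := by
    have hcomp : J' ≫ preimageMap hV Q p hE = F' ≫ J := VPair.Hom.ext hsq
    rw [← A.A.map_comp, ← A.A.map_comp, ← op_comp, ← op_comp, hcomp]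
  have : IsIso (A.A.map (preimageMap hV Q p hE).op ≫ A.A.map J'.op) := by
    rw [hcomm]
    infer_instance
  exact IsIso.of_isIso_comp_right _ (A.A.map J'.op)

/-- Mayer–Vietoris, through excision from `Y` to the neighbourhood `U` of `Z` and the five lemma
on both. -/
lemma isIso_pull_of_cover {E Y : Over k} (p : E ⟶ Y) (hE : V E) (hY : V Y) (Z : Closeds Y.left)
    (U : Y.left.Opens) (hZU : (Z : Set Y.left) ⊆ U) (hZ : IsCompact (Z.compl : Set Y.left))
    (hU : IsCompact (U : Set Y.left)) (hcompl : A.PullIsoOver p (openIncl Y Z.compl))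
    (hopen : A.PullIsoOver p (openIncl Y U))
    (hinter : A.PullIsoOver p (openIncl (openSub Y U) ((openIncl Y U).left ⁻¹ᵁ Z.compl) ≫
      openIncl Y U)) : IsIso (A.pull hE hY p) := by
  let Q : VPair V := ⟨Y, Z, hY, hV.open_mem hY _ hZ⟩
  have hYU := hV.open_mem hY _ hU
  have hEU := hV.preimage_mem hE hY p hU
  let Q' : VPair V := preimagePair hV Q (openIncl Y U) hYU
  have hrestrict := isPullback_openRestrict p U
  have hF' : IsIso (A.A.map (preimageMap hV Q' (openRestrict p U) hEU).op) :=
    A.isIso_map_of_isIso_pull _ _ (preimageComplMap_comp_resMap hV Q' (openRestrict p U) hEU)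
      (hopen _ _ hrestrict _ _)
      (hinter _ _ ((isPullback_openRestrict (openRestrict p U) Q'.Z.compl).paste_horiz hrestrict)
        _ _)
  exact A.isIso_pull_of_isIso_map _ _ (preimageComplMap_comp_resMap hV Q p hE)
    (isIso_map_preimageMap_of_neighbourhood Q p hE hYU hEU hZU hF')
    (hcompl _ _ (isPullback_openRestrict p Z.compl) _ _)

lemma pullIsoOver_of_trivOver {E Y T : Over k} {p : E ⟶ Y} {f : T ⟶ Y} (h : TrivOver p f) :
    A.PullIsoOver p f := by
  obtain ⟨τ, h⟩ := h
  intro E' g p' h' hE hT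
  let e : E' ≅ T ⊗ affineLine k := h'.isoIsPullback _ _ h
  have hTA : V (T ⊗ affineLine k) := hV.iso_mem e hE
  have hfst : IsIso (A.pull hTA hT (fst T (affineLine k))) := A.homotopy T hT hTA
  have he : e.hom ≫ fst T (affineLine k) = p' := h'.isoIsPullback_hom_snd _ _ h
  rw [← he, A.pull_comp hE hTA hT]
  infer_instance

variable (A) in
/-- Every base change of `p` along an open immersion with image in `D` induces an isomorphism. -/
def PullIsoBelow {E Y : Over k} (p : E ⟶ Y) (D : Y.left.Opens) : Prop :=
  ∀ {T : Over k} (f : T ⟶ Y), IsOpenImmersion f.left → Set.range f.left ⊆ D → A.PullIsoOver p f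

lemma PullIsoBelow.bot {E Y : Over k} (p : E ⟶ Y) : A.PullIsoBelow p ⊥ := by
  intro T f _ hf E' g p' _ hE hT
  have hT' : IsEmpty T.left := ⟨fun x => (hf ⟨x, rfl⟩ : _ ∈ (⊥ : Y.left.Opens))⟩
  have : IsIso ((Over.forget k).map p') := (isIso_of_isEmpty p'.left :)
  have : IsIso p' := isIso_of_reflects_iso p' (Over.forget k)
  infer_instance

lemma PullIsoBelow.sup {E Y : Over k} {p : E ⟶ Y} (hY : V Y) {D₁ D₂ : Y.left.Opens}
    (hD₁ : IsCompact (D₁ : Set Y.left)) (hD₂ : IsCompact (D₂ : Set Y.left))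
    (H₁ : A.PullIsoBelow p D₁) (H₂ : A.PullIsoBelow p D₂) : A.PullIsoBelow p (D₁ ⊔ D₂) := by
  intro T f hf hD E' g p' h hE hT
  have := hV.quasiCompact hT hY f
  let Z : Closeds T.left := (f.left ⁻¹ᵁ D₁).compl
  have hZ : Z.compl = f.left ⁻¹ᵁ D₁ := TopologicalSpace.Opens.compl_compl _
  have hZ' : (Z.compl : Set T.left) = (f.left ⁻¹ᵁ D₁ : T.left.Opens) := congrArg _ hZ
  have restrict {D : Y.left.Opens} (H : A.PullIsoBelow p D) {T' : Over k} (j : T' ⟶ T)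
      (hj : IsOpenImmersion j.left) (hD : Set.range j.left ⊆ (f.left ⁻¹ᵁ D : T.left.Opens)) :
      A.PullIsoOver p' j := by
    intro E'' g' p'' h'
    refine H (j ≫ f) (inferInstanceAs (IsOpenImmersion (j.left ≫ f.left))) ?_ _ _
      (h'.paste_horiz h)
    rintro _ ⟨x, rfl⟩
    exact hD ⟨x, rfl⟩
  refine isIso_pull_of_cover p' hE hT Z (f.left ⁻¹ᵁ D₂) ?_ ?_ ?_ ?_ ?_ ?_
  · intro x hx
    have : f.left x ∈ D₁ ⊔ D₂ := hD ⟨x, rfl⟩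
    exact this.resolve_left hx
  · rw [hZ']
    exact f.left.isCompact_preimage hD₁
  · exact f.left.isCompact_preimage hD₂
  · refine restrict H₁ _ inferInstance ?_
    rw [range_openIncl, hZ']
  · exact restrict H₂ _ inferInstance (range_openIncl _ _).le
  · refine restrict H₂ _ (by rw [Over.comp_left]; infer_instance) ?_
    rintro _ ⟨x, rfl⟩
    exact (range_openIncl T (f.left ⁻¹ᵁ D₂)).le ⟨_, rfl⟩

lemma isIso_pull_of_locally_trivOver {E Y : Over k} (p : E ⟶ Y) (hE : V E) (hY : V Y)
    (h : ∀ y : Y.left, ∃ D : Y.left.Opens, y ∈ D ∧ TrivOver p (openIncl Y D)) :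
    IsIso (A.pull hE hY p) := by
  have := hV.compactSpace hY
  obtain ⟨D, hD, -, H⟩ : ∃ D : Y.left.Opens, (Set.univ : Set Y.left) ⊆ D ∧
      IsCompact (D : Set Y.left) ∧ A.PullIsoBelow p D := by
    refine isCompact_univ.induction_on (p := fun s => ∃ D : Y.left.Opens, s ⊆ (D : Set Y.left) ∧
      IsCompact (D : Set Y.left) ∧ A.PullIsoBelow p D) ?_ ?_ ?_ ?_
    · exact ⟨⊥, Set.empty_subset _, isCompact_empty, PullIsoBelow.bot p⟩
    · rintro s t hst ⟨D, hD, h⟩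
      exact ⟨D, hst.trans hD, h⟩
    · rintro s t ⟨D, hD, hc, H⟩ ⟨D', hD', hc', H'⟩
      exact ⟨D ⊔ D', Set.union_subset_union hD hD', hc.union hc', H.sup hY hc hc' H'⟩
    · intro y _
      obtain ⟨D, hy, H⟩ := h y
      obtain ⟨U, hU, hyU, hUD⟩ := exists_isAffineOpen_mem_and_subset hy
      refine ⟨U, mem_nhdsWithin_of_mem_nhds (U.isOpen.mem_nhds hyU), U, subset_rfl,
        hU.isCompact, fun f _ hf => ?_⟩
      obtain ⟨g, rfl⟩ := exists_comp_openIncl f (hf.trans hUD)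
      exact pullIsoOver_of_trivOver (H.precomp g)
  exact H (𝟙 Y) (inferInstanceAs (IsOpenImmersion (𝟙 Y.left))) (fun x _ => hD trivial) (𝟙 E) p
    (IsPullback.of_horiz_isIso ⟨by simp⟩) hE hY

end CohomologyTheory

/-! ### Open subschemes of Grassmannians -/

section OpenInGrassmannian

/-- The open complement of the zero locus of an ideal. -/
def idealOpen {R : CommRingCat.{u}} (I : Ideal R) : (Spec R).Opens :=
  ⟨(PrimeSpectrum.zeroLocus (I : Set R))ᶜ, (PrimeSpectrum.isClosed_zeroLocus _).isOpen_compl⟩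

lemma forall_mem_idealOpen_iff {R R' : CommRingCat.{u}} (I : Ideal R) (g : R ⟶ R') :
    (∀ z : Spec R', Spec.map g z ∈ idealOpen I) ↔ I.map g.hom = ⊤ := by
  rw [← PrimeSpectrum.zeroLocus_empty_iff_eq_top, Ideal.map, PrimeSpectrum.zeroLocus_span,
    ← PrimeSpectrum.preimage_comap_zeroLocus, Set.eq_empty_iff_forall_notMem]
  rfl

lemma isOpenInGrassmannian_of_ideal {k : Scheme.{u}} {r N : ℕ} {X Y : Over k} (p : Y ⟶ X)
    (taut : ∀ {R : CommRingCat.{u}}, (Spec R ⟶ Y.left) → Submodule R (Fin N → R))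
    (hsub : ∀ {R : CommRingCat.{u}} (y : Spec R ⟶ Y.left), IsSubbundle r (taut y))
    (hcomp : ∀ {R R' : CommRingCat.{u}} (g : R ⟶ R') (y : Spec R ⟶ Y.left),
      taut (Spec.map g ≫ y) = pullbackSub g.hom (taut y))
    (hext : ∀ {R : CommRingCat.{u}} (y y' : Spec R ⟶ Y.left), y ≫ p.left = y' ≫ p.left →
      taut y = taut y' → y = y')
    (I : ∀ {R : CommRingCat.{u}}, Submodule R (Fin N → R) → Ideal R)
    (hI : ∀ {R R' : CommRingCat.{u}} (g : R ⟶ R') (M : Submodule R (Fin N → R)),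
      I (R := R') (pullbackSub g.hom M) = (I M).map g.hom)
    (htop : ∀ {R : CommRingCat.{u}} (M : Submodule R (Fin N → R)), IsSubbundle r M →
      ∀ x : Spec R ⟶ X.left, (∃ y : Spec R ⟶ Y.left, y ≫ p.left = x ∧ taut y = M) ↔ I M = ⊤) :
    IsOpenInGrassmannian r N p := by
  refine ⟨taut, hsub, hcomp, fun x M hM => ⟨idealOpen (I M), fun g =>
    ⟨fun y y' hy hyM hy' hyM' => hext y y' (hy.trans hy'.symm) (hyM.trans hyM'.symm), ?_⟩⟩⟩
  rw [forall_mem_idealOpen_iff, ← hI]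
  exact htop _ (hM.pullback g.hom) _

end OpenInGrassmannian

/-! ### Affine spaces in admissible categories -/

section Line

variable {R : Type u} [CommRing R]

/-- The line spanned by `(1, c)`; it is the graph of multiplication by `c`. -/
def lineSub (c : R) : Submodule R (Fin 2 → R) := Submodule.span R {![1, c]}

lemma mem_lineSub {c : R} {x : Fin 2 → R} : x ∈ lineSub c ↔ x 1 = x 0 * c := by
  rw [lineSub, Submodule.mem_span_singleton]
  constructor
  · rintro ⟨a, rfl⟩
    simp
  · intro h
    exact ⟨x 0, by ext j; fin_cases j <;> simp [h]⟩

lemma isSubbundle_lineSub (c : R) : IsSubbundle 1 (lineSub c) := by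
  rw [lineSub, ← LinearMap.range_toSpanSingleton]
  refine isSubbundle_range (q := LinearMap.proj 0) (fun p => ?_) ?_
  · have := p.nontrivial
    simp
  · ext
    simp

lemma pullbackSub_lineSub {R' : Type u} [CommRing R'] (g : R →+* R') (c : R) :
    pullbackSub g (lineSub c) = lineSub (g c) := by
  have hg : (fun j => g (![1, c] j)) = ![1, g c] := by
    ext j
    fin_cases j <;> simp
  rw [lineSub, pullbackSub_span, Set.image_singleton, hg, lineSub]

lemma lineSub_injective : Function.Injective (lineSub (R := R)) := by
  intro c c' h
  have hmem : ![1, c] ∈ lineSub c' := h ▸ Submodule.mem_span_singleton_self _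
  simpa [mem_lineSub] using hmem

lemma IsSubbundle.mul_comm_coords {M : Submodule R (Fin 2 → R)} (h : IsSubbundle 1 M)
    {x y : Fin 2 → R} (hx : x ∈ M) (hy : y ∈ M) : x 0 * y 1 = x 1 * y 0 := by
  rw [← sub_eq_zero]
  refine eq_zero_of_forall_localization fun p => ?_
  obtain ⟨e, he⟩ := h.exists_local_generators p
  obtain ⟨cx, hx⟩ := he x hx
  obtain ⟨cy, hy⟩ := he y hy
  simp only [map_sub, map_mul, hx, hy, Fin.sum_univ_one]
  ring

/-- The ideal of the first coordinates of the elements of a submodule. -/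
def firstIdeal (M : Submodule R (Fin 2 → R)) : Ideal R := M.map (LinearMap.proj 0)

lemma firstIdeal_pullback {R' : Type u} [CommRing R'] (g : R →+* R')
    (M : Submodule R (Fin 2 → R)) : firstIdeal (pullbackSub g M) = (firstIdeal M).map g := by
  rw [firstIdeal, pullbackSub, Submodule.map_span, Ideal.map, firstIdeal, Ideal.span]
  congr 1
  ext r
  simp

lemma IsSubbundle.firstIdeal_eq_top_iff {M : Submodule R (Fin 2 → R)} (h : IsSubbundle 1 M) :
    firstIdeal M = ⊤ ↔ ∃ c, lineSub c = M := by
  rw [Ideal.eq_top_iff_one]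
  constructor
  · rintro ⟨x, hx, hx0 : x 0 = 1⟩
    have hx' : ![1, x 1] = x := by
      ext j
      fin_cases j
      exacts [hx0.symm, rfl]
    refine ⟨x 1, le_antisymm (Submodule.span_le.2 ?_) fun y hy => ?_⟩
    · rwa [Set.singleton_subset_iff, hx']
    · rw [mem_lineSub, mul_comm, ← h.mul_comm_coords hx hy, hx0, one_mul]
  · rintro ⟨c, rfl⟩
    exact ⟨![1, c], Submodule.mem_span_singleton_self _, rfl⟩

end Line

section AffineLine

variable {k : Scheme.{u}} {X : Over k} {R R' : CommRingCat.{u}}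

/-- The coordinate of an affine point of the affine line over `X`. -/
def lineCoord (y : Spec R ⟶ (X ⊗ affineLine k).left) : R :=
  (Scheme.ΓSpecIso R).hom (y.appTop (coordsOf (snd X (affineLine k)) ⟨⟩))

lemma lineCoord_comp (g : R ⟶ R') (y : Spec R ⟶ (X ⊗ affineLine k).left) :
    lineCoord (Spec.map g ≫ y) = g.hom (lineCoord y) :=
  ConcreteCategory.congr_hom (Scheme.ΓSpecIso_naturality g)
    (y.appTop (coordsOf (snd X (affineLine k)) ⟨⟩))

lemma lineCoord_ext {y y' : Spec R ⟶ (X ⊗ affineLine k).left}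
    (h : y ≫ (fst X (affineLine k)).left = y' ≫ (fst X (affineLine k)).left)
    (hcoord : lineCoord y = lineCoord y') : y = y' := by
  have hw (z : Spec R ⟶ (X ⊗ affineLine k).left) :
      (z ≫ (snd X (affineLine k)).left) ≫ (affineLine k).hom =
        (z ≫ (fst X (affineLine k)).left) ≫ X.hom := by
    simp only [Category.assoc, Over.w]
  refine Over.tensorObj_ext _ _ h (AffineSpace.hom_ext ?_ fun j => ?_)
  · exact (hw y).trans ((congrArg (· ≫ X.hom) h).trans (hw y').symm)
  · exact (ConcreteCategory.bijective_of_isIso (Scheme.ΓSpecIso R).hom).1 hcoord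

lemma exists_lineCoord_eq (x : Spec R ⟶ X.left) (c : R) :
    ∃ y : Spec R ⟶ (X ⊗ affineLine k).left,
      y ≫ (fst X (affineLine k)).left = x ∧ lineCoord y = c := by
  let x' : Over.mk (x ≫ X.hom) ⟶ X := Over.homMk x
  let y : _ ⟶ X ⊗ affineLine k := lift x' (pointOf _ fun _ => (Scheme.ΓSpecIso R).inv c)
  refine ⟨y.left, congrArg CommaMorphism.left (lift_fst x' _), ?_⟩
  have hy : coordsOf (y ≫ snd X (affineLine k)) ⟨⟩ = (Scheme.ΓSpecIso R).inv c := by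
    rw [lift_snd, coordsOf_pointOf]
  exact (congrArg (Scheme.ΓSpecIso R).hom hy).trans <|
    ConcreteCategory.congr_hom (Scheme.ΓSpecIso R).inv_hom_id c

lemma isOpenInGrassmannian_fst (X : Over k) :
    IsOpenInGrassmannian 1 2 (fst X (affineLine k)) := by
  refine isOpenInGrassmannian_of_ideal _ (fun y => lineSub (lineCoord y))
    (fun y => isSubbundle_lineSub _) (fun g y => ?_)
    (fun y y' h h' => lineCoord_ext h (lineSub_injective h')) firstIdeal
    (fun g M => firstIdeal_pullback g.hom M) fun M hM x => ?_
  · rw [lineCoord_comp, pullbackSub_lineSub]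
  · rw [hM.firstIdeal_eq_top_iff]
    constructor
    · rintro ⟨y, -, hy⟩
      exact ⟨_, hy⟩
    · rintro ⟨c, rfl⟩
      obtain ⟨y, hy, rfl⟩ := exists_lineCoord_eq x c
      exact ⟨y, hy, rfl⟩

lemma isAffineHom_snd (X : Over k) {L : Over k} (h : IsAffineHom L.hom) :
    IsAffineHom (snd L X).left :=
  MorphismProperty.of_isPullback (P := @IsAffineHom)
    (IsPullback.of_hasPullback L.hom X.hom) h

lemma isAffineHom_fst (X : Over k) {L : Over k} (h : IsAffineHom L.hom) :
    IsAffineHom (fst X L).left :=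
  MorphismProperty.of_isPullback (P := @IsAffineHom)
    (IsPullback.of_hasPullback X.hom L.hom).flip h

lemma IsAdmissible.line_mem {V : ObjectProperty (Over k)} (hV : IsAdmissible V) (hX : V X) :
    V (X ⊗ affineLine k) :=
  hV.grassmannian_mem (fst X (affineLine k)) 1 2 hX
    (isAffineHom_fst X (inferInstanceAs (IsAffineHom (𝔸(PUnit; k) ↘ k))))
    (isOpenInGrassmannian_fst X)

end AffineLine

section AffineSpaces

variable {k : Scheme.{u}}

/-- The reindexing of coordinates, which on points is precomposition with `φ`. -/
def affineSpMap {ι ι' : Type u} (φ : ι → ι') : affineSp k ι' ⟶ affineSp k ι :=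
  pointOf _ fun j => coordsOf (𝟙 _) (φ j)

lemma coordsOf_comp_affineSpMap {ι ι' : Type u} (φ : ι → ι') {T : Over k}
    (x : T ⟶ affineSp k ι') : coordsOf (x ≫ affineSpMap φ) = coordsOf x ∘ φ := by
  rw [coordsOf_comp, affineSpMap, coordsOf_pointOf]
  exact funext fun j => congrArg (coordsOf · (φ j)) (Category.comp_id x)

/-- The isomorphism of affine spaces induced by a bijection of the coordinates. -/
def affineSpReindex {ι ι' : Type u} (e : ι ≃ ι') : affineSp k ι ≅ affineSp k ι' where
  hom := affineSpMap e.symm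
  inv := affineSpMap e
  hom_inv_id := coordsOf_injective <| by
    rw [coordsOf_comp_affineSpMap, ← Category.id_comp (affineSpMap e.symm),
      coordsOf_comp_affineSpMap, Function.comp_assoc, e.symm_comp_self, Function.comp_id]
  inv_hom_id := coordsOf_injective <| by
    rw [coordsOf_comp_affineSpMap, ← Category.id_comp (affineSpMap e),
      coordsOf_comp_affineSpMap, Function.comp_assoc, e.self_comp_symm, Function.comp_id]

/-- The isomorphism splitting off the coordinate with index `none`. -/
def affineSpOptionIso (ι : Type u) : affineSp k (Option ι) ≅ affineSp k ι ⊗ affineLine k where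
  hom := lift (affineSpMap some) (affineSpMap fun _ => none)
  inv := pointOf _ fun o => o.elim (coordsOf (snd _ (affineLine k)) ⟨⟩) (coordsOf (fst _ _))
  hom_inv_id := coordsOf_injective <| funext fun o => by
    rw [coordsOf_comp, coordsOf_pointOf, ← Category.id_comp (lift _ _)]
    beta_reduce
    cases o with
    | none =>
      rw [Option.elim_none, ← congrFun (coordsOf_comp _ _), Category.assoc, lift_snd,
        coordsOf_comp_affineSpMap, Function.comp_apply]
    | some j =>
      rw [Option.elim_some, ← congrFun (coordsOf_comp _ _), Category.assoc, lift_fst,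
        coordsOf_comp_affineSpMap, Function.comp_apply]
  inv_hom_id := by
    ext1 <;> rw [Category.assoc, Category.id_comp] <;> refine coordsOf_injective ?_
    · rw [lift_fst, coordsOf_comp_affineSpMap, coordsOf_pointOf]
      rfl
    · rw [lift_snd, coordsOf_comp_affineSpMap, coordsOf_pointOf]
      rfl

variable {V : ObjectProperty (Over k)} {hV : IsAdmissible V} (A : CohomologyTheory.{w} hV)
  {S : Over k} (hS : V S)

/-- The cohomology theory `A` does not distinguish `X × S` from `S`. -/
def CohomologyTheory.AcyclicOver (X : Over k) : Prop :=
  ∃ hXS : V (X ⊗ S), IsIso (A.pull hXS hS (snd X S))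

variable {A hS}

lemma CohomologyTheory.AcyclicOver.of_iso {X Y : Over k} (e : X ≅ Y) (h : A.AcyclicOver hS X) :
    A.AcyclicOver hS Y := by
  obtain ⟨hX, h⟩ := h
  let e' := whiskerRightIso e S
  have hY : V (Y ⊗ S) := hV.iso_mem e' hX
  refine ⟨hY, ?_⟩
  have hsnd : e'.inv ≫ snd X S = snd Y S := whiskerRight_snd _ _
  rw [← hsnd, A.pull_comp hY hX hS]
  infer_instance

lemma CohomologyTheory.AcyclicOver.tensor_affineLine {X : Over k} (h : A.AcyclicOver hS X) :
    A.AcyclicOver hS (X ⊗ affineLine k) := by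
  obtain ⟨hX, h⟩ := h
  obtain ⟨e, hsnd⟩ : ∃ e : (X ⊗ affineLine k) ⊗ S ≅ (X ⊗ S) ⊗ affineLine k,
      e.hom ≫ fst _ _ ≫ snd X S = snd _ S :=
    ⟨{  hom := lift (lift (fst _ _ ≫ fst _ _) (snd _ _)) (fst _ _ ≫ snd _ _)
        inv := lift (lift (fst _ _ ≫ fst _ _) (snd _ _)) (fst _ _ ≫ snd _ _) }, by simp⟩
  have hXL : V ((X ⊗ S) ⊗ affineLine k) := hV.line_mem hX
  have hXL' := hV.iso_mem e.symm hXL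
  refine ⟨hXL', ?_⟩
  have hfst : IsIso (A.pull hXL hX (fst _ _)) := A.homotopy _ hX hXL
  rw [← hsnd, A.pull_comp hXL' hXL hS, A.pull_comp hXL hX hS]
  infer_instance

variable (A hS) in
lemma CohomologyTheory.acyclicOver_affineSp (ι : Type u) [Finite ι] :
    A.AcyclicOver hS (affineSp k ι) := by
  induction ι using Finite.induction_empty_option with
  | of_equiv e h => exact h.of_iso (affineSpReindex e)
  | h_empty =>
    have : IsIso (snd (affineSp k PEmpty.{u + 1}) S) := by
      refine ⟨lift (pointOf S fun j => j.elim) (𝟙 S), ?_, lift_snd _ _⟩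
      ext1
      · exact coordsOf_injective (funext fun j => j.elim)
      · simp
    exact ⟨hV.iso_mem (asIso (snd (affineSp k PEmpty.{u + 1}) S)).symm hS, A.isIso_pull _ _ _⟩
  | h_option h => exact h.tensor_affineLine.of_iso (affineSpOptionIso _).symm

end AffineSpaces

/-! ### Strata in admissible categories -/

section PluckerMem

variable {κ κ' J : Type} [Fintype J] {s t : J → κ}

lemma IsPlucker.comap {R : Type u} [CommRing R] {W : κ' → κ' → R} (φ : κ → κ')
    (h : IsPlucker (φ ∘ s) (φ ∘ t) W) : IsPlucker s t fun a b => W (φ a) (φ b) where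
  alt _ := h.alt _
  skew _ _ := h.skew _ _
  rel _ _ _ _ := h.rel _ _ _ _
  norm := h.norm

lemma IsPlucker.reindex {R : Type u} [CommRing R] {W : κ → κ → R} (h : IsPlucker s t W)
    (e : κ ≃ κ') : IsPlucker (e ∘ s) (e ∘ t) fun a b => W (e.symm a) (e.symm b) :=
  .comap e.symm <| by
    rwa [← Function.comp_assoc, ← Function.comp_assoc, e.symm_comp_self, Function.id_comp,
      Function.id_comp]

variable {k : Scheme.{u}} {S : Over k} {R R' : CommRingCat.{u}}

/-- The Plücker coordinates of an affine point of `pluckerScheme s t k × S`. -/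
def prodCoords (y : Spec R ⟶ (pluckerScheme s t k ⊗ S).left) (a b : κ) : R :=
  (Scheme.ΓSpecIso R).hom (pluckerCoords (y ≫ (fst (pluckerScheme s t k) S).left) a b)

lemma isPlucker_prodCoords (y : Spec R ⟶ (pluckerScheme s t k ⊗ S).left) :
    IsPlucker s t (prodCoords y) :=
  (isPlucker_pluckerCoords _).map (Scheme.ΓSpecIso R).hom.hom

lemma prodCoords_comp (g : R ⟶ R') (y : Spec R ⟶ (pluckerScheme s t k ⊗ S).left) :
    prodCoords (Spec.map g ≫ y) = fun a b => g.hom (prodCoords y a b) := by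
  ext a b
  simp only [prodCoords, Category.assoc, pluckerCoords_comp (Spec.map g)]
  exact ConcreteCategory.congr_hom (Scheme.ΓSpecIso_naturality g) _

lemma prodCoords_ext {y y' : Spec R ⟶ (pluckerScheme s t k ⊗ S).left}
    (h : y ≫ (snd (pluckerScheme s t k) S).left = y' ≫ (snd (pluckerScheme s t k) S).left)
    (hcoords : prodCoords y = prodCoords y') : y = y' := by
  have hw (z : Spec R ⟶ (pluckerScheme s t k ⊗ S).left) :
      (z ≫ (fst (pluckerScheme s t k) S).left) ≫ (pluckerScheme s t k).hom =
        (z ≫ (snd (pluckerScheme s t k) S).left) ≫ S.hom := by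
    simp only [Category.assoc, Over.w]
  refine Over.tensorObj_ext _ _ (pluckerScheme_hom_ext ?_ (funext₂ fun a b => ?_)) h
  · exact (hw y).trans ((congrArg (· ≫ S.hom) h).trans (hw y').symm)
  · exact (ConcreteCategory.bijective_of_isIso (Scheme.ΓSpecIso R).hom).1
      (congrFun₂ hcoords a b)

lemma exists_prodCoords_eq (x : Spec R ⟶ S.left) {W : κ → κ → R} (hW : IsPlucker s t W) :
    ∃ y : Spec R ⟶ (pluckerScheme s t k ⊗ S).left,
      y ≫ (snd (pluckerScheme s t k) S).left = x ∧ prodCoords y = W := by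
  obtain ⟨g, hg, hgW⟩ := exists_pluckerCoords_eq (x ≫ S.hom)
    (hW.map (Scheme.ΓSpecIso R).inv.hom)
  let x' : Over.mk (x ≫ S.hom) ⟶ S := Over.homMk x
  let g' : Over.mk (x ≫ S.hom) ⟶ pluckerScheme s t k := Over.homMk g hg
  refine ⟨(lift g' x').left, congrArg CommaMorphism.left (lift_snd g' x'), ?_⟩
  have hfst : (lift g' x').left ≫ (fst (pluckerScheme s t k) S).left = g :=
    congrArg CommaMorphism.left (lift_fst g' x')
  ext a b
  rw [prodCoords, hfst, hgW]
  exact ConcreteCategory.congr_hom (Scheme.ΓSpecIso R).inv_hom_id (W a b)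

lemma isOpenInGrassmannian_snd {N : ℕ} (e : κ ≃ Fin N) :
    IsOpenInGrassmannian 2 N (snd (pluckerScheme s t k) S) := by
  refine isOpenInGrassmannian_of_ideal _
    (fun y => rowSpan fun a b => prodCoords y (e.symm a) (e.symm b))
    (fun y => ((isPlucker_prodCoords y).reindex e).isSubbundle) (fun g y => ?_)
    (fun y y' h hspan => prodCoords_ext h ?_) (valueIdeal (e ∘ s) (e ∘ t))
    (fun g M => valueIdeal_pullback g.hom M) fun M hM x => ⟨?_, fun htop => ?_⟩
  · rw [prodCoords_comp, pullbackSub_rowSpan]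
  · have heq := ((isPlucker_prodCoords y).reindex e).eq_of_rowSpan_eq
      ((isPlucker_prodCoords y').reindex e) hspan
    ext a b
    simpa only [e.symm_apply_apply] using congrFun₂ heq (e a) (e b)
  · rintro ⟨y, -, rfl⟩
    exact ((isPlucker_prodCoords y).reindex e).valueIdeal_eq_top
  · obtain ⟨W, hW, rfl⟩ := hM.minorsVanish.exists_isPlucker htop
    obtain ⟨y, hy, hyW⟩ := exists_prodCoords_eq (k := k) x (hW.comap e)
    refine ⟨y, hy, ?_⟩
    simp only [hyW, e.apply_symm_apply]

lemma IsAdmissible.pluckerScheme_mem [Finite κ] {V : ObjectProperty (Over k)}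
    (hV : IsAdmissible V) (s t : J → κ) (hS : V S) : V (pluckerScheme s t k ⊗ S) := by
  obtain ⟨N, ⟨e⟩⟩ := Finite.exists_equiv_fin κ
  exact hV.grassmannian_mem (snd (pluckerScheme s t k) S) 2 N hS
    (isAffineHom_snd S inferInstance) (isOpenInGrassmannian_snd e)

lemma isCompact_preimage_offHyperplane [Finite κ] {T : Scheme.{u}} [CompactSpace T]
    (f : T ⟶ (pluckerScheme s t k).left) (c : κ) :
    IsCompact ((f ⁻¹ᵁ offHyperplane c : T.Opens) : Set T) := by
  rw [preimage_offHyperplane, TopologicalSpace.Opens.coe_iSup]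
  exact isCompact_iUnion fun a => AlgebraicGeometry.isCompact_basicOpen _ isCompact_univ _

end PluckerMem

section Stratum

variable {k : Scheme.{u}} {n i : ℕ} {S : Over k} {V : ObjectProperty (Over k)}
  {hV : IsAdmissible V}

lemma IsAdmissible.openSub_tensor_mem (hV : IsAdmissible V) {X : Over k} (h : V (X ⊗ S))
    (U : X.left.Opens)
    (hU : IsCompact (((fst X S).left ⁻¹ᵁ U : (X ⊗ S).left.Opens) : Set (X ⊗ S).left)) :
    V (openSub X U ⊗ S) :=
  hV.iso_mem ((isPullback_openRestrict (fst X S) U).isoIsPullback _ _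
    (isPullback_whiskerRight_fst (openIncl X U) S)) (hV.open_mem h _ hU)

lemma IsAdmissible.stratumScheme_mem (hV : IsAdmissible V) (hS : V S) :
    V (stratumScheme k n i ⊗ S) := by
  have hX := hV.pluckerScheme_mem (perpSrc n i) (perpTgt n i) hS
  have := hV.compactSpace hX
  exact hV.openSub_tensor_mem hX _ (isCompact_preimage_offHyperplane _ _)

lemma trivOver_self {E Y : Over k} {σ : affineLine k ⊗ E ⟶ E} {p : E ⟶ Y}
    (h : IsPullback σ (snd (affineLine k) E) p p) : TrivOver p p := by
  have hswap : IsPullback (lift (snd E (affineLine k)) (fst E (affineLine k)))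
      (fst E (affineLine k)) (snd (affineLine k) E) (𝟙 E) := by
    have : IsIso (lift (snd E (affineLine k)) (fst E (affineLine k))) :=
      ⟨lift (snd _ _) (fst _ _), by ext1 <;> simp, by ext1 <;> simp⟩
    exact .of_horiz_isIso ⟨by simp⟩
  have hpaste := hswap.paste_horiz h
  rw [Category.id_comp] at hpaste
  exact ⟨_, hpaste⟩

lemma TrivOver.baseChange {E Y E' Y' T T' : Over k} {p : E ⟶ Y} {p' : E' ⟶ Y'} {q : E' ⟶ E}
    {g : Y' ⟶ Y} (hp : IsPullback q p' p g) {f : T ⟶ Y} (h : TrivOver p f) (f' : T' ⟶ Y')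
    (r : T' ⟶ T) (hr : f' ≫ g = r ≫ f) : TrivOver p' f' := by
  obtain ⟨τ, hτ⟩ := h.precomp r
  rw [← hr] at hτ
  refine ⟨hp.lift τ (fst _ _ ≫ f') (by rw [hτ.w, Category.assoc]), ?_⟩
  refine IsPullback.of_right ?_ (hp.lift_snd _ _ _) hp
  rwa [hp.lift_fst]

lemma trivOver_cellProj_openIncl {U : (stratumScheme k n i).left.Opens} (hU : IsAffineOpen U) :
    TrivOver (cellProj k n i) (openIncl (stratumScheme k n i) U) := by
  have : IsAffine U := hU
  obtain ⟨s, hs⟩ := exists_comp_cellProj_eq U.ι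
  let s' : openSub (stratumScheme k n i) U ⟶ affineSp k (CellIdx.{u} n i) := Over.homMk s <| by
    change s ≫ (affineSp k (CellIdx.{u} n i)).hom = U.ι ≫ (stratumScheme k n i).hom
    rw [← hs, Category.assoc, Over.w]
  have hs' : s' ≫ cellProj k n i = openIncl (stratumScheme k n i) U := Over.OverMorphism.ext hs
  rw [← hs']
  exact (trivOver_self isPullback_cellProj).precomp s'

lemma exists_trivOver_cellProj (S : Over k) (x : (stratumScheme k n i ⊗ S).left) :
    ∃ D : (stratumScheme k n i ⊗ S).left.Opens, x ∈ D ∧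
      TrivOver (cellProj k n i ▷ S) (openIncl (stratumScheme k n i ⊗ S) D) := by
  let g := fst (stratumScheme k n i) S
  obtain ⟨U, hU, hxU, -⟩ := exists_isAffineOpen_mem_and_subset (U := ⊤) (x := g.left x) trivial
  exact ⟨g.left ⁻¹ᵁ U, hxU, (trivOver_cellProj_openIncl hU).baseChange
    (isPullback_whiskerRight_fst (cellProj k n i) S).flip _ (openRestrict g U)
    (isPullback_openRestrict g U).w⟩

lemma CohomologyTheory.acyclicOver_stratumScheme (A : CohomologyTheory.{w} hV) (hS : V S) :
    A.AcyclicOver hS (stratumScheme k n i) := by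
  have hX : V (stratumScheme k n i ⊗ S) := hV.stratumScheme_mem hS
  obtain ⟨hE, hAE⟩ := A.acyclicOver_affineSp hS (CellIdx.{u} n i)
  have hproj : IsIso (A.pull hE hX (cellProj k n i ▷ S)) :=
    isIso_pull_of_locally_trivOver _ hE hX (exists_trivOver_cellProj S)
  rw [← whiskerRight_snd (cellProj k n i) S, A.pull_comp hE hX hS] at hAE
  exact ⟨hX, .of_isIso_comp_right _ (A.pull hE hX (cellProj k n i ▷ S))⟩

end Stratum

end QuatProj

end

theorem theoremA (k : Scheme.{u}) (n i : ℕ) (hi : i ≤ n) :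
    (∃ X : Over k, Nonempty (IsStratum n i X)) ∧
    ∀ X : Over k, IsStratum n i X →
      (IsGaAction (cellAction k n i) ∧ IsFreeGa (cellAction k n i) ∧
        ∃ π : affineSp k (CellIdx.{u} n i) ⟶ X, IsGaQuotient (cellAction k n i) π) ∧
      ∀ (V : ObjectProperty (Over k)) (hV : IsAdmissible V) (A : CohomologyTheory.{w} hV)
        (S : Over k) (hS : V S),
        ∃ hXS : V (X ⊗ S), IsIso (A.pull hXS hS (snd X S)) := by
  refine ⟨⟨_, ⟨isStratum_stratumScheme hi⟩⟩, fun X hX => ?_⟩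
  obtain ⟨e⟩ := (isStratum_stratumScheme hi).nonempty_iso hX
  exact ⟨⟨isGaAction_cellAction, isFreeGa_cellAction, _, isGaQuotient_of_iso e⟩,
    fun V hV A S hS => (A.acyclicOver_stratumScheme hS).of_iso e⟩
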